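/- Let $G=\{G(x),x\in\mathbb{R}\}$ be a real-valued, (jointly) measurable, mean-zero Gaussian process with stationary increments on a probability space, and let $\sigma^2(h)=E(G(x+h)-G(x))^2$, $\sigma(h)\ge 0$. Assume that for some $\delta>0$ the function $\sigma^2$ is concave and nondecreasing on $[0,\delta]$ and $\sigma^2(\delta)>0$ (so that $\sigma(h)>0$ for $0<h\le\delta$). Let $1\le p<\infty$ and let $\{h_n\}$ be positive numbers with $h_n=o\left((\log n)^{-p}\right)$ as $n\to\infty$. Then, almost surely, for all $a,b\in\mathbb{R}$, $$\int_a^b\left|\frac{G(x+h_n)-G(x)}{\sigma(h_n)}\right|^p dx$$ is a convergent Lebesgue integral for every $n$ with $\sigma(h_n)>0$ (hence for all large $n$), and $$\lim_{n\to\infty}\int_a^b\left|\frac{G(x+h_n)-G(x)}{\sigma(h_n)}\right|^p dx=E|\eta|^p\,(b-a),$$ where $\eta$ is a normal random variable with mean zero and variance one. No continuity or boundedness of the paths of $G$ is assumed. -/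

import Mathlib

open MeasureTheory ProbabilityTheory Filter Topology Asymptotics

/-- A real-valued process `G` indexed by `ℝ` has stationary increments under `μ`: the
finite-dimensional distributions of `x ↦ G (t + x) - G t` do not depend on `t`. -/
def HasStationaryIncrements {Ω : Type*} [MeasurableSpace Ω] (G : ℝ → Ω → ℝ) (μ : Measure Ω) :
    Prop :=
  ∀ (t : ℝ) (I : Finset ℝ),
    IdentDistrib (fun ω (x : I) ↦ G (t + x) ω - G t ω) (fun ω (x : I) ↦ G x ω - G 0 ω) μ μ

/-- The increment variance `σ²(h) = E (G(x + h) - G(x))²`, evaluated at `x = 0`; for a process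
with stationary increments the value is the same at every `x`. -/
noncomputable def incrementVariance {Ω : Type*} [MeasurableSpace Ω] (G : ℝ → Ω → ℝ)
    (μ : Measure Ω) (h : ℝ) : ℝ :=
  ∫ ω, (G h ω - G 0 ω) ^ 2 ∂μ

/-- The definition of `incrementVariance` does not depend on the base point. -/
theorem HasStationaryIncrements.integral_sq_increment {Ω : Type*} [MeasurableSpace Ω]
    {G : ℝ → Ω → ℝ} {μ : Measure Ω} (hG : HasStationaryIncrements G μ) (x h : ℝ) :
    ∫ ω, (G (x + h) ω - G x ω) ^ 2 ∂μ = incrementVariance G μ h := by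
  have h1 := (hG x {h}).comp (measurable_pi_apply (⟨h, by simp⟩ : ({h} : Finset ℝ)))
  exact h1.sq.integral_eq

/-- The normalization `σ(h)`, the nonnegative square root of the increment variance. -/
noncomputable def incrementStd {Ω : Type*} [MeasurableSpace Ω] (G : ℝ → Ω → ℝ)
    (μ : Measure Ω) (h : ℝ) : ℝ :=
  √(incrementVariance G μ h)

/-! On a short interval let `F n` be the `L^p` mean, to the power `1 / p`, of the increments divided
by `σ(h n)`. For large `n` each standardized increment is standard normal, so `F n ^ p` has
expectation exactly `E|η|^p`. Only concentration of `F n` has to be proved.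

Concentration comes from the Maurey–Pisier rotation argument (`lintegral_exp_sub_le_of_isGaussian`).
If `s` bounds the variances of all subgradients of a convex positively homogeneous `F`, the
difference of two independent copies of `F` has Laplace transform at most `exp(l² π² s / 8)`. For an
`L^p` mean, Hölder's inequality bounds these variances by the power `1 / p` of the mean absolute
correlation over pairs of points (`integral_sq_powerMeanSubgrad_le`). Concavity of `σ²` makes
increments more than `h` apart nonpositively correlated, and the second differences of `σ²`
telescope, so this mean is `O(h)` whatever the size of `σ(h)` (`lintegral_incrementCorr_le`). The
parameters are thus `O(h n ^ (1 / p)) = o(1 / log n)`, the tails are summable, and Borel–Cantelli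
applies (`ae_tendsto_of_subgaussian`).

The paths are merely measurable, so the rotation argument is run on finite Gaussian vectors.
Randomly chosen sample points turn the `L^p` mean into a limit of finite power means while
controlling the pair correlations (`exists_sample`), and Fatou's lemma carries the bound over
(`lintegral_exp_lpMean_sub_le`). Monotonicity in the endpoints and additivity extend the limit from
short rational intervals to all intervals. -/

/-! ### Maurey–Pisier concentration by discrete rotations -/

section MaureyPisier

variable {E : Type*} [NormedAddCommGroup E] [NormedSpace ℝ E] [CompleteSpace E]
  [SecondCountableTopology E] [MeasurableSpace E] [BorelSpace E]

/-- Exponential moments of a continuous linear functional under a centered Gaussian measure. -/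
theorem lintegral_exp_dual_of_isGaussian (ν : Measure E) [IsGaussian ν] (hν : ν[id] = 0)
    (L : StrongDual ℝ E) (t : ℝ) :
    ∫⁻ y, ENNReal.ofReal (Real.exp (t * L y)) ∂ν
      = ENNReal.ofReal (Real.exp (t ^ 2 * (∫ y, (L y) ^ 2 ∂ν) / 2)) := by
  have hL : ∫ y, L y ∂ν = 0 := by
    have := IsGaussian.integral_dual (μ := ν) L
    simp only [id_eq] at hν
    rw [this, hν, map_zero]
  have hvar : Var[L; ν] = ∫ y, (L y) ^ 2 ∂ν :=
    variance_of_integral_eq_zero L.continuous.measurable.aemeasurable hL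
  have hmap : ν.map L = gaussianReal 0 (Var[L; ν]).toNNReal := by
    rw [IsGaussian.map_eq_gaussianReal L, hL]
  have hint : Integrable (fun y ↦ Real.exp (t * L y)) ν := by
    have h1 := integrable_exp_mul_gaussianReal (μ := 0) (v := (Var[L; ν]).toNNReal) t
    rw [← hmap] at h1
    exact h1.comp_measurable L.continuous.measurable
  rw [← ofReal_integral_eq_lintegral_ofReal hint (ae_of_all _ fun _ ↦ (Real.exp_pos _).le)]
  have h2 := mgf_gaussianReal hmap t
  rw [mgf] at h2
  rw [h2, Real.coe_toNNReal _ (variance_nonneg _ _), hvar]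
  congr 2
  ring

/-- With the first coordinate `x` fixed, `f x` is a centered Gaussian variable of variance at most
`s`, so the inner integral is an explicit Laplace transform. -/
theorem lintegral_exp_rotation_step (ν : Measure E) [IsGaussian ν] (hν : ν[id] = 0)
    {F : E → ℝ} {f : E → StrongDual ℝ E} (hF : Measurable F)
    (hf : Measurable fun z : E × E ↦ f z.1 z.2) {s : ℝ}
    (hs : ∀ x, ∫ y, (f x y) ^ 2 ∂ν ≤ s) (a b : ℝ) :
    ∫⁻ z, ENNReal.ofReal (Real.exp (a * F z.1 - b * f z.1 z.2)) ∂(ν.prod ν)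
      ≤ ENNReal.ofReal (Real.exp (b ^ 2 * s / 2)) * ∫⁻ x, ENNReal.ofReal (Real.exp (a * F x)) ∂ν := by
  rw [lintegral_prod _ (by fun_prop)]
  rw [← lintegral_const_mul _ (by fun_prop)]
  refine lintegral_mono fun x ↦ ?_
  have : ∀ y, ENNReal.ofReal (Real.exp (a * F x - b * f x y))
      = ENNReal.ofReal (Real.exp (a * F x)) * ENNReal.ofReal (Real.exp ((-b) * f x y)) := by
    intro y
    rw [← ENNReal.ofReal_mul (Real.exp_pos _).le, ← Real.exp_add]
    congr 2; ring
  simp only [this]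
  rw [lintegral_const_mul _ (by fun_prop), lintegral_exp_dual_of_isGaussian ν hν, mul_comm]
  refine mul_le_mul_left (ENNReal.ofReal_le_ofReal (Real.exp_le_exp.2 ?_)) _
  rw [neg_sq]
  have := hs x
  gcongr

omit [CompleteSpace E] [SecondCountableTopology E] [MeasurableSpace E] [BorelSpace E] in
/-- Splitting a quarter turn into `N` equal rotations. -/
theorem exp_sub_le_sum_rotation {F : E → ℝ} {f : E → StrongDual ℝ E}
    (hsub : ∀ x y, F x - F y ≤ f x (x - y)) (hself : ∀ x, f x x = F x)
    {l : ℝ} (hl : 0 ≤ l) {N : ℕ} (hN : 0 < N) (z : E × E) :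
    Real.exp (l * (F z.1 - F z.2)) ≤ ∑ k ∈ Finset.range N, (N : ℝ)⁻¹ *
      Real.exp ((l * N * (1 - Real.cos (Real.pi / 2 / N)))
          * F (ContinuousLinearMap.rotation (k * (Real.pi / 2 / N)) z).1
        - (l * N * Real.sin (Real.pi / 2 / N))
          * f (ContinuousLinearMap.rotation (k * (Real.pi / 2 / N)) z).1
              (ContinuousLinearMap.rotation (k * (Real.pi / 2 / N)) z).2) := by
  have hN' : (N : ℝ) ≠ 0 := by positivity
  set ε : ℝ := Real.pi / 2 / N with hε
  have hNε : (N : ℝ) * ε = Real.pi / 2 := by rw [hε]; field_simp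
  set R : ℕ → E × E := fun k ↦ ContinuousLinearMap.rotation (k * ε) z with hR
  have h0 : (R 0).1 = z.1 := by simp [hR, ContinuousLinearMap.rotation_apply]
  have h1 : (R N).1 = z.2 := by simp [hR, ContinuousLinearMap.rotation_apply, hNε]
  have hstep : ∀ k, (R (k + 1)).1 = Real.cos ε • (R k).1 + Real.sin ε • (R k).2 := by
    intro k
    simp only [hR, ContinuousLinearMap.rotation_apply]
    have : ((k + 1 : ℕ) : ℝ) * ε = k * ε + ε := by push_cast; ring
    rw [this, Real.cos_add, Real.sin_add]
    module
  have hT : ∀ k, F (R k).1 - F (R (k + 1)).1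
      ≤ (1 - Real.cos ε) * F (R k).1 - Real.sin ε * f (R k).1 (R k).2 := by
    intro k
    refine (hsub _ _).trans (le_of_eq ?_)
    rw [hstep, map_sub, map_add, map_smul, map_smul, hself]
    simp only [smul_eq_mul]
    ring
  have htel : F z.1 - F z.2 ≤ ∑ k ∈ Finset.range N,
      ((1 - Real.cos ε) * F (R k).1 - Real.sin ε * f (R k).1 (R k).2) := by
    rw [← h0, ← h1, ← Finset.sum_range_sub' (fun k ↦ F (R k).1)]
    exact Finset.sum_le_sum fun k _ ↦ hT k
  -- Jensen with uniform weights: the telescoped sum is written as an average of `N` times its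
  -- terms, which is where the factors `l * N` come from.
  have hconv := convexOn_exp.map_sum_le (t := Finset.range N) (w := fun _ ↦ (N : ℝ)⁻¹)
    (p := fun k ↦ l * N * ((1 - Real.cos ε) * F (R k).1 - Real.sin ε * f (R k).1 (R k).2))
    (fun _ _ ↦ by positivity) (by simp [hN']) (fun _ _ ↦ Set.mem_univ _)
  simp only [smul_eq_mul] at hconv
  calc Real.exp (l * (F z.1 - F z.2))
      ≤ Real.exp (∑ k ∈ Finset.range N, (N : ℝ)⁻¹ *
        (l * N * ((1 - Real.cos ε) * F (R k).1 - Real.sin ε * f (R k).1 (R k).2))) := by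
        rw [Real.exp_le_exp]
        refine (mul_le_mul_of_nonneg_left htel hl).trans (le_of_eq ?_)
        rw [Finset.mul_sum]
        refine Finset.sum_congr rfl fun k _ ↦ ?_
        field_simp
    _ ≤ _ := hconv
    _ = _ := by
        refine Finset.sum_congr rfl fun k _ ↦ ?_
        congr 2
        ring

/-- Rotations preserve `ν.prod ν`, so all `N` terms of the averaged bound have the same integral.
The constant `π² / 8` is half of `(π / 2)²`, because `N * |sin ε| ≤ N * ε = π / 2`. -/
theorem lintegral_exp_sub_le_of_rotation (ν : Measure E) [IsGaussian ν] (hν : ν[id] = 0)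
    {F : E → ℝ} {f : E → StrongDual ℝ E} (hF : Measurable F)
    (hf : Measurable fun z : E × E ↦ f z.1 z.2)
    (hsub : ∀ x y, F x - F y ≤ f x (x - y)) (hself : ∀ x, f x x = F x) {s : ℝ}
    (hs : ∀ x, ∫ y, (f x y) ^ 2 ∂ν ≤ s) {l : ℝ} (hl : 0 ≤ l) {N : ℕ} (hN : 0 < N) :
    ∫⁻ z, ENNReal.ofReal (Real.exp (l * (F z.1 - F z.2))) ∂(ν.prod ν)
      ≤ ENNReal.ofReal (Real.exp (l ^ 2 * (Real.pi ^ 2 * s / 8))) *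
        ∫⁻ x, ENNReal.ofReal
          (Real.exp ((l * N * (1 - Real.cos (Real.pi / 2 / N))) * F x)) ∂ν := by
  have hN' : (0 : ℝ) < N := by positivity
  set ε : ℝ := Real.pi / 2 / N with hε
  have hs0 : 0 ≤ s := (integral_nonneg fun y ↦ sq_nonneg _).trans (hs 0)
  set g : E × E → ℝ := fun z ↦ (l * N * (1 - Real.cos ε)) * F z.1 - (l * N * Real.sin ε) * f z.1 z.2
    with hg
  have hgm : Measurable g := by fun_prop
  have hinv : ∀ θ : ℝ, ∫⁻ z, ENNReal.ofReal (Real.exp (g (ContinuousLinearMap.rotation θ z)))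
      ∂(ν.prod ν) = ∫⁻ z, ENNReal.ofReal (Real.exp (g z)) ∂(ν.prod ν) := by
    intro θ
    conv_rhs => rw [← IsGaussian.map_rotation_eq_self (μ := ν) hν θ]
    rw [lintegral_map (by fun_prop) (by fun_prop)]
  have hsin : (l * N * Real.sin ε) ^ 2 * s / 2 ≤ l ^ 2 * (Real.pi ^ 2 * s / 8) := by
    have hε0 : 0 ≤ ε := by positivity
    have h1 : |Real.sin ε| ≤ ε := by simpa [abs_of_nonneg hε0] using Real.abs_sin_le_abs (x := ε)
    have h2 : (Real.sin ε) ^ 2 ≤ ε ^ 2 := by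
      rw [← sq_abs (Real.sin ε)]; gcongr
    have h3 : (N : ℝ) ^ 2 * ε ^ 2 = Real.pi ^ 2 / 4 := by rw [hε]; field_simp; norm_num
    calc (l * N * Real.sin ε) ^ 2 * s / 2 = l ^ 2 * N ^ 2 * s / 2 * (Real.sin ε) ^ 2 := by ring
      _ ≤ l ^ 2 * N ^ 2 * s / 2 * ε ^ 2 := by gcongr
      _ = l ^ 2 * s / 2 * (N ^ 2 * ε ^ 2) := by ring
      _ = _ := by rw [h3]; ring
  calc ∫⁻ z, ENNReal.ofReal (Real.exp (l * (F z.1 - F z.2))) ∂(ν.prod ν)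
      ≤ ∫⁻ z, ∑ k ∈ Finset.range N, ENNReal.ofReal (N : ℝ)⁻¹ *
          ENNReal.ofReal (Real.exp (g (ContinuousLinearMap.rotation (k * ε) z))) ∂(ν.prod ν) := by
        refine lintegral_mono fun z ↦ ?_
        refine (ENNReal.ofReal_le_ofReal (exp_sub_le_sum_rotation hsub hself hl hN z)).trans ?_
        rw [ENNReal.ofReal_sum_of_nonneg (fun _ _ ↦ by positivity)]
        refine Finset.sum_le_sum fun k _ ↦ ?_
        rw [ENNReal.ofReal_mul (by positivity)]
    _ = ∑ k ∈ Finset.range N, ENNReal.ofReal (N : ℝ)⁻¹ *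
          ∫⁻ z, ENNReal.ofReal (Real.exp (g z)) ∂(ν.prod ν) := by
        rw [lintegral_finsetSum _ (fun _ _ ↦ by fun_prop)]
        refine Finset.sum_congr rfl fun k _ ↦ ?_
        rw [lintegral_const_mul _ (by fun_prop), hinv]
    _ = ∫⁻ z, ENNReal.ofReal (Real.exp (g z)) ∂(ν.prod ν) := by
        rw [Finset.sum_const, Finset.card_range, nsmul_eq_mul, ← mul_assoc,
          ← ENNReal.ofReal_natCast, ← ENNReal.ofReal_mul (by positivity),
          mul_inv_cancel₀ hN'.ne', ENNReal.ofReal_one, one_mul]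
    _ ≤ _ := lintegral_exp_rotation_step ν hν hF hf hs _ _
    _ ≤ _ := by gcongr

/-- Fernique's theorem, after completing the square to bound `c ‖x‖` by `C ‖x‖² + c² / (4 C)`. -/
theorem integrable_exp_mul_norm_of_isGaussian (ν : Measure E) [IsGaussian ν] (c : ℝ) :
    Integrable (fun x ↦ Real.exp (c * ‖x‖)) ν := by
  obtain ⟨C, hC, hint⟩ := IsGaussian.exists_integrable_exp_sq ν
  refine (hint.const_mul (Real.exp (c ^ 2 / (4 * C)))).mono'
    (by fun_prop) (ae_of_all _ fun x ↦ ?_)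
  rw [Real.norm_of_nonneg (Real.exp_pos _).le, ← Real.exp_add, Real.exp_le_exp]
  have : 0 ≤ (2 * C * ‖x‖ - c) ^ 2 / (4 * C) := by positivity
  have h2 : (2 * C * ‖x‖ - c) ^ 2 / (4 * C) = C * ‖x‖ ^ 2 - c * ‖x‖ + c ^ 2 / (4 * C) := by
    field_simp; ring
  linarith

/-- **Maurey–Pisier concentration** for a positively homogeneous convex function `F` with
subgradient selection `f`: the difference of two independent copies is sub-Gaussian. -/
theorem lintegral_exp_sub_le_of_isGaussian (ν : Measure E) [IsGaussian ν] (hν : ν[id] = 0)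
    {F : E → ℝ} {f : E → StrongDual ℝ E} (hF : Measurable F)
    (hf : Measurable fun z : E × E ↦ f z.1 z.2)
    (hsub : ∀ x y, F x - F y ≤ f x (x - y)) (hself : ∀ x, f x x = F x)
    {C : ℝ} (hFC : ∀ x, F x ≤ C * ‖x‖) {s : ℝ}
    (hs : ∀ x, ∫ y, (f x y) ^ 2 ∂ν ≤ s) {l : ℝ} (hl : 0 ≤ l) :
    ∫⁻ z, ENNReal.ofReal (Real.exp (l * (F z.1 - F z.2))) ∂(ν.prod ν)
      ≤ ENNReal.ofReal (Real.exp (l ^ 2 * (Real.pi ^ 2 * s / 8))) := by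
  set c : ℕ → ℝ := fun N ↦ l * N * (1 - Real.cos (Real.pi / 2 / N)) with hc
  have hc0 : ∀ N, 0 ≤ c N := fun N ↦ by
    have := Real.cos_le_one (Real.pi / 2 / N)
    have : 0 ≤ 1 - Real.cos (Real.pi / 2 / N) := by linarith
    positivity
  have hcle : ∀ N : ℕ, c N ≤ l * (Real.pi ^ 2 / 8) * (N : ℝ)⁻¹ := by
    intro N
    rcases Nat.eq_zero_or_pos N with rfl | hN
    · simp [hc]
    have hN' : (0 : ℝ) < N := by positivity
    have h1 := Real.one_sub_sq_div_two_le_cos (x := Real.pi / 2 / N)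
    calc c N ≤ l * N * ((Real.pi / 2 / N) ^ 2 / 2) := by
          simp only [hc]; gcongr; linarith
      _ = _ := by field_simp; norm_num
  have hclim : Tendsto c atTop (𝓝 0) := by
    refine squeeze_zero hc0 hcle ?_
    simpa only [mul_zero] using
      (tendsto_inv_atTop_nhds_zero_nat (𝕜 := ℝ)).const_mul (l * (Real.pi ^ 2 / 8))
  have hcb : ∀ N, c N ≤ l * (Real.pi ^ 2 / 8) := fun N ↦ (hcle N).trans (by
    have : (N : ℝ)⁻¹ ≤ 1 := Nat.cast_inv_le_one N
    exact mul_le_of_le_one_right (by positivity) this)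
  -- As `1 - cos (π / 2 / N)` is of order `N⁻²`, the coefficient `c N` tends to `0` and the residual
  -- exponential moment disappears in the limit. Linear growth of `F` and Fernique give the
  -- domination.
  have hlim : Tendsto (fun N ↦ ∫⁻ x, ENNReal.ofReal (Real.exp (c N * F x)) ∂ν) atTop
      (𝓝 (∫⁻ x, ENNReal.ofReal (Real.exp (0 * F x)) ∂ν)) := by
    refine tendsto_lintegral_of_dominated_convergence
      (fun x ↦ ENNReal.ofReal (Real.exp ((l * (Real.pi ^ 2 / 8) * |C|) * ‖x‖)))
      (fun N ↦ by fun_prop) (fun N ↦ ae_of_all _ fun x ↦ ?_) ?_ (ae_of_all _ fun x ↦ ?_)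
    · refine ENNReal.ofReal_le_ofReal (Real.exp_le_exp.2 ?_)
      calc c N * F x ≤ c N * (|C| * ‖x‖) := by
            refine mul_le_mul_of_nonneg_left ((hFC x).trans ?_) (hc0 N)
            gcongr; exact le_abs_self C
        _ ≤ (l * (Real.pi ^ 2 / 8)) * (|C| * ‖x‖) := by gcongr; exact hcb N
        _ = _ := by ring
    · exact (integrable_exp_mul_norm_of_isGaussian ν _).lintegral_lt_top.ne
    · exact ENNReal.tendsto_ofReal
        ((Real.continuous_exp.tendsto _).comp (hclim.mul_const (F x)))
  have hlim2 := ENNReal.Tendsto.const_mul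
    (a := ENNReal.ofReal (Real.exp (l ^ 2 * (Real.pi ^ 2 * s / 8)))) hlim
    (Or.inr ENNReal.ofReal_ne_top)
  simp only [zero_mul, Real.exp_zero, ENNReal.ofReal_one, lintegral_const, measure_univ,
    mul_one] at hlim2
  refine ge_of_tendsto hlim2 ?_
  filter_upwards [eventually_gt_atTop 0] with N hN
  exact lintegral_exp_sub_le_of_rotation ν hν hF hf hsub hself hs hl hN

end MaureyPisier

/-! ### Power means, their subgradients and Hölder's inequality -/

section PowerMean

/-- Weighted Hölder inequality, in a form which includes the exponent `p = 1`. -/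
theorem sum_mul_rpow_sub_one_mul_le {κ : Type*} (t : Finset κ) {p : ℝ} (hp : 1 ≤ p)
    {w a b : κ → ℝ} (hw : ∀ k, 0 ≤ w k) (ha : ∀ k, 0 ≤ a k) (hb : ∀ k, 0 ≤ b k)
    (ha1 : ∑ k ∈ t, w k * a k ^ p ≤ 1) :
    ∑ k ∈ t, w k * (a k ^ (p - 1) * b k) ≤ (∑ k ∈ t, w k * b k ^ p) ^ (1 / p) := by
  have hp0 : 0 < p := by linarith
  have hterm : ∀ k ∈ t, 0 ≤ w k * b k ^ p := fun k _ ↦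
    mul_nonneg (hw k) (Real.rpow_nonneg (hb k) p)
  have hB0 : 0 ≤ ∑ k ∈ t, w k * b k ^ p := Finset.sum_nonneg hterm
  rcases hB0.eq_or_lt with hB | hB
  · have hz := (Finset.sum_eq_zero_iff_of_nonneg hterm).1 hB.symm
    rw [Finset.sum_eq_zero]
    · positivity
    · intro k hk
      rcases mul_eq_zero.1 (hz k hk) with h | h
      · simp [h]
      · rw [Real.rpow_eq_zero (hb k) hp0.ne'] at h
        simp [h]
  · set B := ∑ k ∈ t, w k * b k ^ p with hBdef
    have hβ : 0 < B ^ (1 / p) := Real.rpow_pos_of_pos hB _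
    have hβp : (B ^ (1 / p)) ^ p = B := by
      rw [← Real.rpow_mul hB.le, one_div_mul_cancel hp0.ne', Real.rpow_one]
    have hp1 : 0 ≤ 1 - 1 / p := by
      have : 1 / p ≤ 1 := by rw [div_le_one hp0]; exact hp
      linarith
    -- Young's inequality with weights `1 - 1 / p` and `1 / p`; no conjugate exponent occurs, so `p
    -- = 1` needs no separate treatment.
    have key : ∀ k, a k ^ (p - 1) * (b k / B ^ (1 / p))
        ≤ (1 - 1 / p) * a k ^ p + 1 / p * (b k ^ p / B) := by
      intro k
      have h := Real.geom_mean_le_arith_mean2_weighted hp1 (by positivity : 0 ≤ 1 / p)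
        (Real.rpow_nonneg (ha k) p)
        (Real.rpow_nonneg (div_nonneg (hb k) hβ.le) p) (by ring)
      rw [← Real.rpow_mul (ha k), ← Real.rpow_mul (div_nonneg (hb k) hβ.le),
        mul_one_div_cancel hp0.ne', Real.rpow_one, Real.div_rpow (hb k) hβ.le, hβp] at h
      convert h using 3
      field_simp
    have : ∑ k ∈ t, w k * (a k ^ (p - 1) * (b k / B ^ (1 / p))) ≤ 1 := by
      calc _ ≤ ∑ k ∈ t, w k * ((1 - 1 / p) * a k ^ p + 1 / p * (b k ^ p / B)) :=
            Finset.sum_le_sum fun k _ ↦ mul_le_mul_of_nonneg_left (key k) (hw k)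
        _ = (1 - 1 / p) * ∑ k ∈ t, w k * a k ^ p + 1 / p * (B / B) := by
            rw [hBdef, Finset.sum_div, Finset.mul_sum, Finset.mul_sum, ← Finset.sum_add_distrib]
            refine Finset.sum_congr rfl fun k _ ↦ ?_
            ring
        _ ≤ (1 - 1 / p) * 1 + 1 / p * 1 := by
            rw [div_self hB.ne']; gcongr
        _ = 1 := by ring
    calc _ = B ^ (1 / p) * ∑ k ∈ t, w k * (a k ^ (p - 1) * (b k / B ^ (1 / p))) := by
          rw [Finset.mul_sum]
          refine Finset.sum_congr rfl fun k _ ↦ ?_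
          field_simp
      _ ≤ B ^ (1 / p) * 1 := by gcongr
      _ = _ := mul_one _

variable {ι : Type*} [Fintype ι]

/-- The power mean `(|ι|⁻¹ ∑ |x i| ^ p) ^ (1 / p)`. -/
noncomputable def powerMean (p : ℝ) (x : ι → ℝ) : ℝ :=
  (∑ i, (Fintype.card ι : ℝ)⁻¹ * |x i| ^ p) ^ (1 / p)

/-- The coefficients of the subgradient of `powerMean`. -/
noncomputable def powerMeanCoeff (p : ℝ) (x : ι → ℝ) (i : ι) : ℝ :=
  (Fintype.card ι : ℝ)⁻¹ * ((x i / |x i|) * (|x i| / powerMean p x) ^ (p - 1))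

/-- A subgradient of `powerMean` at `x`. -/
noncomputable def powerMeanSubgrad (p : ℝ) (x : ι → ℝ) : StrongDual ℝ (ι → ℝ) :=
  ∑ i, powerMeanCoeff p x i • ContinuousLinearMap.proj (R := ℝ) (φ := fun _ : ι ↦ ℝ) i

theorem powerMeanSubgrad_apply (p : ℝ) (x y : ι → ℝ) :
    powerMeanSubgrad p x y = ∑ i, powerMeanCoeff p x i * y i := by
  simp [powerMeanSubgrad]

theorem powerMean_nonneg (p : ℝ) (x : ι → ℝ) : 0 ≤ powerMean p x := by
  unfold powerMean; positivity

theorem measurable_powerMean (p : ℝ) : Measurable (powerMean p : (ι → ℝ) → ℝ) := by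
  unfold powerMean; fun_prop

theorem measurable_powerMeanSubgrad (p : ℝ) :
    Measurable fun z : (ι → ℝ) × (ι → ℝ) ↦ powerMeanSubgrad p z.1 z.2 := by
  simp only [powerMeanSubgrad_apply, powerMeanCoeff]
  have := measurable_powerMean (ι := ι) p
  fun_prop

theorem powerMean_rpow {p : ℝ} (hp : 1 ≤ p) (x : ι → ℝ) :
    powerMean p x ^ p = ∑ i, (Fintype.card ι : ℝ)⁻¹ * |x i| ^ p := by
  rw [powerMean, ← Real.rpow_mul (by positivity), one_div_mul_cancel (by linarith), Real.rpow_one]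

theorem eq_zero_of_powerMean_eq_zero {p : ℝ} (hp : 1 ≤ p) {x : ι → ℝ} (hx : powerMean p x = 0)
    (i : ι) : x i = 0 := by
  have hp0 : p ≠ 0 := by linarith
  have h := powerMean_rpow hp x
  rw [hx, Real.zero_rpow hp0] at h
  have := (Finset.sum_eq_zero_iff_of_nonneg (fun i _ ↦ by positivity)).1 h.symm i (Finset.mem_univ i)
  have hc : (Fintype.card ι : ℝ)⁻¹ ≠ 0 := by
    have : Nonempty ι := ⟨i⟩
    positivity
  rcases mul_eq_zero.1 this with h | h
  · exact absurd h hc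
  · rw [Real.rpow_eq_zero (abs_nonneg _) hp0] at h
    simpa using h

/-- Equality holds unless the power mean vanishes, in which case division by zero makes the left
side `0`. -/
theorem sum_abs_div_powerMean_rpow_le {p : ℝ} (hp : 1 ≤ p) (x : ι → ℝ) :
    ∑ i, (Fintype.card ι : ℝ)⁻¹ * (|x i| / powerMean p x) ^ p ≤ 1 := by
  have h0 := powerMean_nonneg p x
  have : ∑ i, (Fintype.card ι : ℝ)⁻¹ * (|x i| / powerMean p x) ^ p
      = powerMean p x ^ p / powerMean p x ^ p := by
    nth_rewrite 1 [powerMean_rpow hp]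
    rw [Finset.sum_div]
    refine Finset.sum_congr rfl fun i _ ↦ ?_
    rw [Real.div_rpow (abs_nonneg _) h0, mul_div_assoc]
  rw [this]
  exact div_self_le_one _

theorem abs_powerMeanCoeff_le (p : ℝ) (x : ι → ℝ) (i : ι) :
    |powerMeanCoeff p x i| ≤ (Fintype.card ι : ℝ)⁻¹ * (|x i| / powerMean p x) ^ (p - 1) := by
  have h0 := powerMean_nonneg p x
  rw [powerMeanCoeff, abs_mul, abs_mul, abs_of_nonneg (by positivity : 0 ≤ (Fintype.card ι : ℝ)⁻¹),
    abs_of_nonneg (by positivity : 0 ≤ (|x i| / powerMean p x) ^ (p - 1)), abs_div, abs_abs]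
  gcongr
  exact mul_le_of_le_one_left (by positivity) (div_self_le_one _)

/-- Hölder's inequality: the functional lies in the dual unit ball of the power mean. Together with
`powerMeanSubgrad_self` this is the subgradient inequality. -/
theorem powerMeanSubgrad_le {p : ℝ} (hp : 1 ≤ p) (x y : ι → ℝ) :
    powerMeanSubgrad p x y ≤ powerMean p y := by
  have h0 := powerMean_nonneg p x
  rw [powerMeanSubgrad_apply]
  calc ∑ i, powerMeanCoeff p x i * y i
      ≤ ∑ i, (Fintype.card ι : ℝ)⁻¹ * ((|x i| / powerMean p x) ^ (p - 1) * |y i|) := by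
        refine Finset.sum_le_sum fun i _ ↦ (le_abs_self _).trans ?_
        rw [abs_mul, ← mul_assoc]
        gcongr
        exact abs_powerMeanCoeff_le p x i
    _ ≤ _ := sum_mul_rpow_sub_one_mul_le _ hp (fun _ ↦ by positivity) (fun _ ↦ by positivity)
        (fun _ ↦ abs_nonneg _) (sum_abs_div_powerMean_rpow_le hp x)

theorem powerMeanSubgrad_self {p : ℝ} (hp : 1 ≤ p) (x : ι → ℝ) :
    powerMeanSubgrad p x x = powerMean p x := by
  have h0 := powerMean_nonneg p x
  rw [powerMeanSubgrad_apply]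
  rcases h0.eq_or_lt with h | h
  · rw [← h, Finset.sum_eq_zero]
    intro i _
    rw [eq_zero_of_powerMean_eq_zero hp h.symm i, mul_zero]
  · have hterm : ∀ i, powerMeanCoeff p x i * x i
        = ((Fintype.card ι : ℝ)⁻¹ * |x i| ^ p) / powerMean p x ^ (p - 1) := by
      intro i
      rw [powerMeanCoeff, Real.div_rpow (abs_nonneg _) h.le]
      rcases eq_or_ne (x i) 0 with hx | hx
      · simp [hx, Real.zero_rpow (by linarith : p ≠ 0)]
      · have h1 : x i / |x i| * x i = |x i| := by
          have : |x i| ≠ 0 := abs_ne_zero.2 hx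
          rw [div_mul_eq_mul_div, div_eq_iff this, ← sq, ← sq, sq_abs]
        have h2 : |x i| ^ p = |x i| ^ (p - 1) * |x i| := by
          rw [← Real.rpow_add_one (abs_ne_zero.2 hx)]; ring_nf
        rw [h2]
        calc _ = (Fintype.card ι : ℝ)⁻¹ * (|x i| ^ (p - 1) / powerMean p x ^ (p - 1))
              * (x i / |x i| * x i) := by ring
          _ = _ := by rw [h1]; ring
    simp only [hterm]
    rw [← Finset.sum_div, ← powerMean_rpow hp, div_eq_iff (by positivity),
      ← Real.rpow_one_add' h.le (by linarith)]
    ring_nf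

theorem powerMean_le_norm [Nonempty ι] {p : ℝ} (hp : 1 ≤ p) (x : ι → ℝ) : powerMean p x ≤ 1 * ‖x‖ := by
  have hp0 : 0 < p := by linarith
  rw [one_mul, ← Real.rpow_le_rpow_iff (powerMean_nonneg p x) (norm_nonneg x) hp0,
    powerMean_rpow hp]
  calc ∑ i, (Fintype.card ι : ℝ)⁻¹ * |x i| ^ p
      ≤ ∑ _i : ι, (Fintype.card ι : ℝ)⁻¹ * ‖x‖ ^ p := by
        refine Finset.sum_le_sum fun i _ ↦ ?_
        gcongr
        exact norm_le_pi_norm x i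
    _ = _ := by simp

/-- The variance is a double sum of products of coefficients against the covariances. Hölder on `ι ×
ι` bounds it by the `L^p` mean of the covariances, and `|cov| ^ p ≤ |cov|` leaves the power `1 / p`
of their mean absolute value. This power is the origin of the exponent in the rate assumed for `h`.
-/
theorem integral_sq_powerMeanSubgrad_le {p : ℝ} (hp : 1 ≤ p) (ν : Measure (ι → ℝ)) [IsGaussian ν]
    (hcov : ∀ i j, |∫ y, y i * y j ∂ν| ≤ 1) (x : ι → ℝ) :
    ∫ y, (powerMeanSubgrad p x y) ^ 2 ∂ν
      ≤ (∑ i, ∑ j, ((Fintype.card ι : ℝ)⁻¹) ^ 2 * |∫ y, y i * y j ∂ν|) ^ (1 / p) := by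
  have h0 := powerMean_nonneg p x
  set w := (Fintype.card ι : ℝ)⁻¹ with hw
  have hw0 : 0 ≤ w := by positivity
  set u : ι → ℝ := fun i ↦ |x i| / powerMean p x with hu
  have hu0 : ∀ i, 0 ≤ u i := fun i ↦ by positivity
  have hcoord : ∀ i, MemLp (fun y : ι → ℝ ↦ y i) 2 ν := fun i ↦
    (IsGaussian.memLp_two_id (μ := ν)).continuousLinearMap_comp
      (ContinuousLinearMap.proj (R := ℝ) (φ := fun _ : ι ↦ ℝ) i)
  have hint : ∀ i j, Integrable (fun y : ι → ℝ ↦ y i * y j) ν := fun i j ↦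
    (hcoord i).integrable_mul (hcoord j)
  have hexp : ∫ y, (powerMeanSubgrad p x y) ^ 2 ∂ν
      = ∑ i, ∑ j, powerMeanCoeff p x i * powerMeanCoeff p x j * ∫ y, y i * y j ∂ν := by
    simp only [powerMeanSubgrad_apply, sq, Finset.sum_mul_sum]
    have : ∀ (y : ι → ℝ) (i j : ι), powerMeanCoeff p x i * y i * (powerMeanCoeff p x j * y j)
        = powerMeanCoeff p x i * powerMeanCoeff p x j * (y i * y j) := by intros; ring
    simp only [this]
    rw [integral_finsetSum _ fun i _ ↦ integrable_finsetSum _ fun j _ ↦ (hint i j).const_mul _]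
    refine Finset.sum_congr rfl fun i _ ↦ ?_
    rw [integral_finsetSum _ fun j _ ↦ (hint i j).const_mul _]
    simp only [integral_const_mul]
  rw [hexp, ← Finset.sum_product', ← Finset.sum_product']
  have hu1 : ∑ k ∈ (Finset.univ : Finset ι) ×ˢ (Finset.univ : Finset ι),
      w ^ 2 * (u k.1 * u k.2) ^ p ≤ 1 := by
    rw [Finset.sum_product]
    have : ∀ i j, w ^ 2 * (u i * u j) ^ p = (w * u i ^ p) * (w * u j ^ p) := by
      intro i j
      rw [Real.mul_rpow (hu0 i) (hu0 j)]; ring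
    simp only [this]
    rw [← Finset.sum_mul_sum]
    have h1 := sum_abs_div_powerMean_rpow_le hp x
    exact mul_le_one₀ h1 (Finset.sum_nonneg fun i _ ↦ by positivity) h1
  calc ∑ k ∈ (Finset.univ : Finset ι) ×ˢ (Finset.univ : Finset ι),
        powerMeanCoeff p x k.1 * powerMeanCoeff p x k.2 * ∫ y, y k.1 * y k.2 ∂ν
      ≤ ∑ k ∈ (Finset.univ : Finset ι) ×ˢ (Finset.univ : Finset ι),
        w ^ 2 * ((u k.1 * u k.2) ^ (p - 1) * |∫ y, y k.1 * y k.2 ∂ν|) := by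
        refine Finset.sum_le_sum fun k _ ↦ (le_abs_self _).trans ?_
        rw [abs_mul, abs_mul, ← mul_assoc]
        refine mul_le_mul_of_nonneg_right ?_ (abs_nonneg _)
        rw [Real.mul_rpow (hu0 _) (hu0 _)]
        calc _ ≤ (w * u k.1 ^ (p - 1)) * (w * u k.2 ^ (p - 1)) := by
              gcongr <;> exact abs_powerMeanCoeff_le p x _
          _ = _ := by ring
    _ ≤ (∑ k ∈ (Finset.univ : Finset ι) ×ˢ (Finset.univ : Finset ι),
          w ^ 2 * |∫ y, y k.1 * y k.2 ∂ν| ^ p) ^ (1 / p) :=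
        sum_mul_rpow_sub_one_mul_le _ hp (fun _ ↦ by positivity)
          (fun _ ↦ mul_nonneg (hu0 _) (hu0 _)) (fun _ ↦ abs_nonneg _) hu1
    _ ≤ _ := by
        gcongr with k
        exact Real.rpow_le_self_of_le_one (abs_nonneg _) (hcov _ _) hp

/-- Concentration of the power mean of a centered Gaussian vector with variances at most `1`. -/
theorem lintegral_exp_powerMean_sub_le [Nonempty ι] {p : ℝ} (hp : 1 ≤ p) (ν : Measure (ι → ℝ))
    [IsGaussian ν] (hν : ν[id] = 0) (hcov : ∀ i j, |∫ y, y i * y j ∂ν| ≤ 1) {l : ℝ} (hl : 0 ≤ l) :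
    ∫⁻ z, ENNReal.ofReal (Real.exp (l * (powerMean p z.1 - powerMean p z.2))) ∂(ν.prod ν)
      ≤ ENNReal.ofReal (Real.exp (l ^ 2 * (Real.pi ^ 2 *
        (∑ i, ∑ j, ((Fintype.card ι : ℝ)⁻¹) ^ 2 * |∫ y, y i * y j ∂ν|) ^ (1 / p) / 8))) := by
  refine lintegral_exp_sub_le_of_isGaussian ν hν (measurable_powerMean p)
    (measurable_powerMeanSubgrad p) (fun x y ↦ ?_) (powerMeanSubgrad_self hp)
    (powerMean_le_norm hp) (integral_sq_powerMeanSubgrad_le hp ν hcov) hl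
  rw [map_sub, powerMeanSubgrad_self hp]
  linarith [powerMeanSubgrad_le hp x y]

end PowerMean

/-! ### Choosing sample points by the probabilistic method -/

section Sampling

variable {S : Type*} [MeasurableSpace S]

theorem integral_eval_pi {n : ℕ} (π : Measure S) [IsProbabilityMeasure π] {g : S → ℝ}
    (hg : Measurable g) (i : Fin n) :
    ∫ x, g (x i) ∂(Measure.pi fun _ : Fin n ↦ π) = ∫ s, g s ∂π := by
  have := (measurePreserving_eval (fun _ : Fin n ↦ π) i)
  conv_rhs => rw [← this.map_eq, integral_map this.measurable.aemeasurable
    (by rw [this.map_eq]; exact hg.aestronglyMeasurable)]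

/-- The mean square error of the empirical mean of an i.i.d. sample. -/
theorem lintegral_sq_empirical_sub_le {n : ℕ} (hn : 0 < n) (π : Measure S)
    [IsProbabilityMeasure π] {g : S → ℝ} (hg : Measurable g) :
    ∫⁻ x, ENNReal.ofReal ((∑ i, (n : ℝ)⁻¹ * g (x i) - ∫ s, g s ∂π) ^ 2)
        ∂(Measure.pi fun _ : Fin n ↦ π)
      ≤ ENNReal.ofReal (n : ℝ)⁻¹ * ∫⁻ s, ENNReal.ofReal (g s ^ 2) ∂π := by
  have hn' : (0 : ℝ) < n := by positivity
  by_cases htop : ∫⁻ s, ENNReal.ofReal (g s ^ 2) ∂π = ⊤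
  · rw [htop, ENNReal.mul_top]
    · exact le_top
    · simpa using hn.ne'
  have hsq : Integrable (fun s ↦ g s ^ 2) π := by
    refine ⟨by fun_prop, ?_⟩
    rw [hasFiniteIntegral_iff_ofReal (ae_of_all _ fun _ ↦ sq_nonneg _)]
    exact lt_top_iff_ne_top.2 htop
  have hL2 : MemLp g 2 π := (memLp_two_iff_integrable_sq hg.aestronglyMeasurable).2 hsq
  have hL2' : ∀ i : Fin n, MemLp (fun x : Fin n → S ↦ g (x i)) 2 (Measure.pi fun _ : Fin n ↦ π) :=
    fun i ↦ hL2.comp_measurePreserving (measurePreserving_eval _ i)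
  set Y : (Fin n → S) → ℝ := fun x ↦ ∑ i, (n : ℝ)⁻¹ * g (x i) with hY
  have hYL2 : MemLp Y 2 (Measure.pi fun _ : Fin n ↦ π) :=
    memLp_finsetSum _ fun i _ ↦ (hL2' i).const_mul _
  have hYmean : ∫ x, Y x ∂(Measure.pi fun _ : Fin n ↦ π) = ∫ s, g s ∂π := by
    simp only [hY]
    rw [integral_finsetSum _ fun i _ ↦ ((hL2' i).integrable one_le_two).const_mul _]
    simp only [integral_const_mul, integral_eval_pi π hg]
    simp [hn'.ne']
  have hvar : Var[Y; Measure.pi fun _ : Fin n ↦ π] ≤ (n : ℝ)⁻¹ * ∫ s, g s ^ 2 ∂π := by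
    have h1 : Y = fun x ↦ (n : ℝ)⁻¹ * (∑ i, fun x : Fin n → S ↦ g (x i)) x := by
      funext x
      simp [hY, Finset.mul_sum]
    rw [h1, variance_const_mul, variance_sum_pi (X := fun _ : Fin n ↦ g) (fun _ ↦ hL2)]
    have h2 : Var[g; π] ≤ ∫ s, g s ^ 2 ∂π := variance_le_expectation_sq hg.aestronglyMeasurable
    calc _ = (n : ℝ)⁻¹ * Var[g; π] := by
          simp only [Finset.sum_const, Finset.card_univ, Fintype.card_fin, nsmul_eq_mul]
          field_simp
      _ ≤ _ := by gcongr
  have h3 := evariance_eq_lintegral_ofReal Y (Measure.pi fun _ : Fin n ↦ π)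
  rw [hYmean] at h3
  rw [← h3, ← ofReal_variance hYL2, ← ofReal_integral_eq_lintegral_ofReal hsq
    (ae_of_all _ fun _ ↦ sq_nonneg _), ← ENNReal.ofReal_mul (by positivity)]
  exact ENNReal.ofReal_le_ofReal hvar

/-- The mean of a kernel bounded by `1` over the pairs of an i.i.d. sample. -/
theorem lintegral_sum_pairs_le {n : ℕ} (hn : 0 < n) (π : Measure S) [IsProbabilityMeasure π]
    {r : S × S → ℝ} (hr : Measurable r) (hr0 : ∀ z, 0 ≤ r z) (hr1 : ∀ z, r z ≤ 1) {V : ℝ}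
    (hV0 : 0 ≤ V) (hV : ∫⁻ z, ENNReal.ofReal (r z) ∂(π.prod π) ≤ ENNReal.ofReal V) :
    ∫⁻ x, ENNReal.ofReal (∑ i, ∑ j, ((n : ℝ)⁻¹) ^ 2 * r (x i, x j))
        ∂(Measure.pi fun _ : Fin n ↦ π) ≤ ENNReal.ofReal (V + (n : ℝ)⁻¹) := by
  -- Independence gives at most `V` for each off-diagonal pair; the `n` diagonal pairs are bounded
  -- by `1` and contribute at most `1 / n` in total.
  classical
  have hn' : (0 : ℝ) < n := by positivity
  have hpair : ∀ i j : Fin n, ∫⁻ x, ENNReal.ofReal (r (x i, x j)) ∂(Measure.pi fun _ : Fin n ↦ π)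
      ≤ ENNReal.ofReal (V + if i = j then 1 else 0) := by
    intro i j
    split_ifs with hij
    · calc _ ≤ ∫⁻ x, 1 ∂(Measure.pi fun _ : Fin n ↦ π) := by
            refine lintegral_mono fun x ↦ ?_
            simpa using hr1 (x i, x j)
        _ = ENNReal.ofReal 1 := by simp
        _ ≤ _ := ENNReal.ofReal_le_ofReal (by linarith)
    · have hind : IndepFun (fun x : Fin n → S ↦ x i) (fun x ↦ x j)
          (Measure.pi fun _ : Fin n ↦ π) :=
        (iIndepFun_pi (X := fun _ : Fin n ↦ (id : S → S)) fun i ↦ aemeasurable_id).indepFun hij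
      have hmap := hind.map_prod_eq_prod_map_map
        (measurable_pi_apply i).aemeasurable (measurable_pi_apply j).aemeasurable
      have he : ∀ i : Fin n, (Measure.pi fun _ : Fin n ↦ π).map (fun x ↦ x i) = π :=
        fun i ↦ (measurePreserving_eval (fun _ : Fin n ↦ π) i).map_eq
      rw [he, he] at hmap
      rw [add_zero]
      refine le_trans (le_of_eq ?_) hV
      rw [← hmap, lintegral_map (by fun_prop) (by fun_prop)]
  have hsum : ∀ x : Fin n → S, ENNReal.ofReal (∑ i, ∑ j, ((n : ℝ)⁻¹) ^ 2 * r (x i, x j))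
      = ∑ i, ∑ j, ENNReal.ofReal (((n : ℝ)⁻¹) ^ 2) * ENNReal.ofReal (r (x i, x j)) := by
    intro x
    have h0 : ∀ i j : Fin n, 0 ≤ ((n : ℝ)⁻¹) ^ 2 * r (x i, x j) := fun i j ↦
      mul_nonneg (by positivity) (hr0 _)
    rw [ENNReal.ofReal_sum_of_nonneg fun i _ ↦ Finset.sum_nonneg fun j _ ↦ h0 i j]
    refine Finset.sum_congr rfl fun i _ ↦ ?_
    rw [ENNReal.ofReal_sum_of_nonneg fun j _ ↦ h0 i j]
    refine Finset.sum_congr rfl fun j _ ↦ ?_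
    rw [ENNReal.ofReal_mul (by positivity)]
  simp only [hsum]
  rw [lintegral_finsetSum _ fun i _ ↦ by fun_prop]
  calc _ ≤ ∑ i : Fin n, ∑ j : Fin n, ENNReal.ofReal (((n : ℝ)⁻¹) ^ 2)
          * ENNReal.ofReal (V + if i = j then 1 else 0) := by
        refine Finset.sum_le_sum fun i _ ↦ ?_
        rw [lintegral_finsetSum _ fun j _ ↦ by fun_prop]
        refine Finset.sum_le_sum fun j _ ↦ ?_
        rw [lintegral_const_mul _ (by fun_prop)]
        gcongr
        exact hpair i j
    _ = ENNReal.ofReal (∑ i : Fin n, ∑ j : Fin n, ((n : ℝ)⁻¹) ^ 2 * (V + if i = j then 1 else 0)) := by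
        have h0 : ∀ i j : Fin n, (0 : ℝ) ≤ V + if i = j then 1 else 0 := by
          intro i j; split_ifs <;> linarith
        rw [ENNReal.ofReal_sum_of_nonneg fun i _ ↦ Finset.sum_nonneg fun j _ ↦
          mul_nonneg (by positivity) (h0 i j)]
        refine Finset.sum_congr rfl fun i _ ↦ ?_
        rw [ENNReal.ofReal_sum_of_nonneg fun j _ ↦ mul_nonneg (by positivity) (h0 i j)]
        refine Finset.sum_congr rfl fun j _ ↦ ?_
        rw [ENNReal.ofReal_mul (by positivity)]
    _ = _ := by
        congr 1
        simp only [← Finset.mul_sum, Finset.sum_add_distrib, Finset.sum_const, Finset.card_univ,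
          Fintype.card_fin, nsmul_eq_mul, Finset.sum_ite_eq, Finset.mem_univ, if_true]
        field_simp

/-- There are `n` sample points for which the empirical means approximate the mean of `g` and the
double averages of `r` are controlled by the double integral of `r`. -/
theorem exists_sample {Ω : Type*} [MeasurableSpace Ω] {n : ℕ} (hn : 0 < n) (π : Measure S)
    [IsProbabilityMeasure π] (μ : Measure Ω) [IsProbabilityMeasure μ] {g : S × Ω → ℝ}
    (hg : Measurable g) {C : ℝ} (hC : 0 < C)
    (hgC : ∫⁻ z, ENNReal.ofReal (g z ^ 2) ∂(π.prod μ) ≤ ENNReal.ofReal C)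
    {r : S × S → ℝ} (hr : Measurable r) (hr0 : ∀ z, 0 ≤ r z) (hr1 : ∀ z, r z ≤ 1) {V : ℝ}
    (hV0 : 0 ≤ V) (hV : ∫⁻ z, ENNReal.ofReal (r z) ∂(π.prod π) ≤ ENNReal.ofReal V)
    {P : S → Prop} (hP : ∀ᵐ s ∂π, P s) :
    ∃ x : Fin n → S, (∀ i, P (x i)) ∧
      ∫⁻ ω, ENNReal.ofReal ((∑ i, (n : ℝ)⁻¹ * g (x i, ω) - ∫ s, g (s, ω) ∂π) ^ 2) ∂μ
        ≤ ENNReal.ofReal (2 * C * (n : ℝ)⁻¹) ∧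
      ∑ i, ∑ j, ((n : ℝ)⁻¹) ^ 2 * r (x i, x j) ≤ 2 * (V + (n : ℝ)⁻¹) := by
  have hn' : (0 : ℝ) < n := by positivity
  set Pi : Measure (Fin n → S) := Measure.pi fun _ : Fin n ↦ π with hPi
  have hmean : Measurable fun ω ↦ ∫ s, g (s, ω) ∂π :=
    (hg.stronglyMeasurable.integral_prod_left' (μ := π)).measurable
  set D : (Fin n → S) × Ω → ENNReal := fun z ↦
    ENNReal.ofReal ((∑ i, (n : ℝ)⁻¹ * g (z.1 i, z.2) - ∫ s, g (s, z.2) ∂π) ^ 2) with hD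
  have hDm : Measurable D := by
    refine (((Finset.measurable_fun_sum _ fun i _ ↦ ?_).sub
      (hmean.comp measurable_snd)).pow_const 2).ennreal_ofReal
    fun_prop
  have hDint : ∫⁻ x, ∫⁻ ω, D (x, ω) ∂μ ∂Pi ≤ ENNReal.ofReal (C * (n : ℝ)⁻¹) := by
    rw [lintegral_lintegral_swap (by fun_prop)]
    calc ∫⁻ ω, ∫⁻ x, D (x, ω) ∂Pi ∂μ
        ≤ ∫⁻ ω, ENNReal.ofReal (n : ℝ)⁻¹ * ∫⁻ s, ENNReal.ofReal (g (s, ω) ^ 2) ∂π ∂μ :=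
          lintegral_mono fun ω ↦ lintegral_sq_empirical_sub_le hn π (g := fun s ↦ g (s, ω))
            (by fun_prop)
      _ = ENNReal.ofReal (n : ℝ)⁻¹ * ∫⁻ z, ENNReal.ofReal (g z ^ 2) ∂(π.prod μ) := by
          rw [lintegral_const_mul _ (by fun_prop), lintegral_prod_symm' _ (by fun_prop)]
      _ ≤ ENNReal.ofReal (n : ℝ)⁻¹ * ENNReal.ofReal C := by gcongr
      _ = _ := by rw [← ENNReal.ofReal_mul (by positivity), mul_comm]
  set K : (Fin n → S) → ENNReal := fun x ↦
    ENNReal.ofReal (∑ i, ∑ j, ((n : ℝ)⁻¹) ^ 2 * r (x i, x j)) with hK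
  have hKm : Measurable K := by fun_prop
  have hKint : ∫⁻ x, K x ∂Pi ≤ ENNReal.ofReal (V + (n : ℝ)⁻¹) :=
    lintegral_sum_pairs_le hn π hr hr0 hr1 hV0 hV
  have hVn : 0 < V + (n : ℝ)⁻¹ := by positivity
  have hCn : 0 < C * (n : ℝ)⁻¹ := by positivity
  -- The weights normalize both error terms to mean at most `1`. Some sample then has weighted sum
  -- at most `2`, so each term exceeds its mean bound by a factor of at most `2`.
  set A : ENNReal := ENNReal.ofReal (C * (n : ℝ)⁻¹)⁻¹ with hA
  set B : ENNReal := ENNReal.ofReal (V + (n : ℝ)⁻¹)⁻¹ with hB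
  have hDm' : Measurable fun x ↦ ∫⁻ ω, D (x, ω) ∂μ := hDm.lintegral_prod_right'
  have htot : ∫⁻ x, (A * ∫⁻ ω, D (x, ω) ∂μ) + B * K x ∂Pi ≤ 2 := by
    rw [lintegral_add_left (by fun_prop), lintegral_const_mul _ hDm', lintegral_const_mul _ hKm]
    calc _ ≤ A * ENNReal.ofReal (C * (n : ℝ)⁻¹) + B * ENNReal.ofReal (V + (n : ℝ)⁻¹) := by gcongr
      _ = 1 + 1 := by
          rw [hA, hB, ← ENNReal.ofReal_mul (by positivity), ← ENNReal.ofReal_mul (by positivity),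
            inv_mul_cancel₀ hCn.ne', inv_mul_cancel₀ hVn.ne', ENNReal.ofReal_one]
      _ = 2 := one_add_one_eq_two
  have hPae : ∀ᵐ x ∂Pi, ∀ i, P (x i) := by
    rw [ae_all_iff]
    intro i
    exact (measurePreserving_eval (fun _ : Fin n ↦ π) i).quasiMeasurePreserving.ae hP
  obtain ⟨x, hx, hxle⟩ := exists_notMem_null_le_lintegral (μ := Pi)
    (f := fun x ↦ (A * ∫⁻ ω, D (x, ω) ∂μ) + B * K x) (by fun_prop) hPae
  have hx' : ∀ i, P (x i) := by simpa using hx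
  have hle := hxle.trans htot
  have hconv : ∀ {y : ENNReal} {c : ℝ}, 0 < c → ENNReal.ofReal c⁻¹ * y ≤ 2 →
      y ≤ ENNReal.ofReal (2 * c) := by
    intro y c hc hy
    calc y = ENNReal.ofReal c * (ENNReal.ofReal c⁻¹ * y) := by
          rw [← mul_assoc, ← ENNReal.ofReal_mul hc.le, mul_inv_cancel₀ hc.ne', ENNReal.ofReal_one,
            one_mul]
      _ ≤ ENNReal.ofReal c * 2 := by gcongr
      _ = _ := by rw [mul_comm, ENNReal.ofReal_mul zero_le_two, ENNReal.ofReal_ofNat]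
  refine ⟨x, hx', ?_, ?_⟩
  · have := hconv hCn ((le_add_of_nonneg_right zero_le).trans hle)
    rwa [← mul_assoc] at this
  · have := hconv hVn ((le_add_of_nonneg_left zero_le).trans hle)
    exact (ENNReal.ofReal_le_ofReal_iff (by positivity)).1 this

end Sampling

/-! ### From finite power means to `L^p` means -/

section GaussianProcessMean

variable {S Ω : Type*} [MeasurableSpace Ω]

/-- Sample points may repeat, so joint Gaussianity is needed along families that are not injective.
-/
theorem ProbabilityTheory.IsGaussianProcess.hasGaussianLaw_fintype {μ : Measure Ω} {Z : S → Ω → ℝ}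
    (hZ : IsGaussianProcess Z μ) {ι : Type*} [Fintype ι] (x : ι → S) :
    HasGaussianLaw (fun ω i ↦ Z (x i) ω) μ :=
  ((hZ.comp_right x).hasGaussianLaw Finset.univ).map
    (ContinuousLinearMap.pi fun i ↦ ContinuousLinearMap.proj (R := ℝ)
      (φ := fun _ : (Finset.univ : Finset ι) ↦ ℝ) ⟨i, Finset.mem_univ i⟩)

theorem integrable_abs_rpow_gaussianReal {q : ℝ} (hq : 0 < q) :
    Integrable (fun y ↦ |y| ^ q) (gaussianReal 0 1) := by
  lift q to NNReal using hq.le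
  have h := memLp_id_gaussianReal (μ := 0) (v := 1) q
  have h2 := h.integrable_norm_rpow (by simpa using hq.ne') ENNReal.coe_ne_top
  simpa using h2

theorem tendstoInMeasure_of_lintegral_sq {μ : Measure Ω} {A : ℕ → Ω → ℝ} {B : Ω → ℝ}
    (hA : ∀ n, Measurable (A n)) (hB : Measurable B)
    (h : Tendsto (fun n ↦ ∫⁻ ω, ENNReal.ofReal ((A n ω - B ω) ^ 2) ∂μ) atTop (𝓝 0)) :
    TendstoInMeasure μ A atTop B := by
  refine tendstoInMeasure_of_tendsto_eLpNorm (p := 2) (by norm_num)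
    (fun n ↦ (hA n).aestronglyMeasurable) hB.aestronglyMeasurable ?_
  have : ∀ n, eLpNorm (A n - B) 2 μ
      = (∫⁻ ω, ENNReal.ofReal ((A n ω - B ω) ^ 2) ∂μ) ^ (1 / 2 : ℝ) := by
    intro n
    rw [eLpNorm_eq_lintegral_rpow_enorm_toReal (by norm_num) (by norm_num)]
    simp only [ENNReal.toReal_ofNat, Pi.sub_apply]
    congr 1
    refine lintegral_congr fun ω ↦ ?_
    rw [← sq_abs, ENNReal.ofReal_pow (abs_nonneg _), ← Real.enorm_eq_ofReal_abs]
    norm_cast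
  simp only [this]
  have h2 := (ENNReal.continuous_rpow_const (y := (1 / 2 : ℝ))).tendsto 0
  rw [ENNReal.zero_rpow_of_pos (by norm_num)] at h2
  exact h2.comp h

/-- At finitely many points `X` agrees almost surely with `Z`, so its vector of values is Gaussian
with the covariances of `Z`, and the finite-dimensional bound is pulled back along it. -/
theorem lintegral_exp_powerMean_process_le {μ : Measure Ω} [IsProbabilityMeasure μ]
    {Z X : S → Ω → ℝ} (hZ : IsGaussianProcess Z μ) {n : ℕ} (hn : 0 < n) {x : Fin n → S}
    (hX : ∀ i, Measurable (X (x i))) (hZX : ∀ i, Z (x i) =ᵐ[μ] X (x i))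
    (hmean : ∀ s, ∫ ω, Z s ω ∂μ = 0) {p : ℝ} (hp : 1 ≤ p)
    (hcov : ∀ i j, |∫ ω, Z (x i) ω * Z (x j) ω ∂μ| ≤ 1) {l : ℝ} (hl : 0 ≤ l) :
    ∫⁻ z, ENNReal.ofReal (Real.exp (l * (powerMean p (fun i ↦ X (x i) z.1)
        - powerMean p (fun i ↦ X (x i) z.2)))) ∂(μ.prod μ)
      ≤ ENNReal.ofReal (Real.exp (l ^ 2 * (Real.pi ^ 2 *
        (∑ i, ∑ j, ((n : ℝ)⁻¹) ^ 2 * |∫ ω, Z (x i) ω * Z (x j) ω ∂μ|) ^ (1 / p) / 8))) := by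
  have : Nonempty (Fin n) := ⟨⟨0, hn⟩⟩
  set T : Ω → Fin n → ℝ := fun ω i ↦ X (x i) ω with hT
  have hTm : Measurable T := measurable_pi_lambda _ hX
  have hTae : (fun ω i ↦ Z (x i) ω) =ᵐ[μ] T := by
    filter_upwards [ae_all_iff.2 hZX] with ω hω
    funext i; exact hω i
  have hgl : HasGaussianLaw T μ := (hZ.hasGaussianLaw_fintype x).congr hTae
  set ν := μ.map T with hν
  have : IsGaussian ν := hgl.isGaussian_map
  have hcoord : ∀ i j, ∫ y, y i * y j ∂ν = ∫ ω, Z (x i) ω * Z (x j) ω ∂μ := by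
    intro i j
    rw [hν, integral_map hTm.aemeasurable (by fun_prop)]
    refine integral_congr_ae ?_
    filter_upwards [hZX i, hZX j] with ω h1 h2
    simp only [hT, h1, h2]
  have hνmean : ν[id] = 0 := by
    funext i
    have h1 := IsGaussian.integral_dual (μ := ν)
      (ContinuousLinearMap.proj (R := ℝ) (φ := fun _ : Fin n ↦ ℝ) i)
    simp only [ContinuousLinearMap.proj_apply] at h1
    simp only [id_eq, Pi.zero_apply]
    rw [← h1, hν, integral_map hTm.aemeasurable (measurable_pi_apply i).aestronglyMeasurable, ← hmean (x i)]
    exact integral_congr_ae (hZX i).symm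
  have key := lintegral_exp_powerMean_sub_le hp ν hνmean (fun i j ↦ by rw [hcoord]; exact hcov i j) hl
  simp only [hcoord, Fintype.card_fin] at key
  have hpm := measurable_powerMean (ι := Fin n) p
  rw [hν, Measure.map_prod_map _ _ hTm hTm, lintegral_map (by fun_prop) (by fun_prop)] at key
  exact key

/-- Concentration of the `L^p` mean of a measurable version `X` of a standardized Gaussian
process `Z`. -/
theorem lintegral_exp_lpMean_sub_le [MeasurableSpace S] {π : Measure S} [IsProbabilityMeasure π]
    {μ : Measure Ω} [IsProbabilityMeasure μ] {Z : S → Ω → ℝ} {X : S → Ω → ℝ}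
    (hZ : IsGaussianProcess Z μ) (hX : Measurable fun z : S × Ω ↦ X z.1 z.2)
    (hmean : ∀ s, ∫ ω, Z s ω ∂μ = 0) (hlaw : ∀ s, μ.map (Z s) = gaussianReal 0 1)
    {P : S → Prop} (hP : ∀ᵐ s ∂π, P s) (hZX : ∀ s, P s → Z s =ᵐ[μ] X s)
    {p : ℝ} (hp : 1 ≤ p) {r : S × S → ℝ} (hr : Measurable r) (hr1 : ∀ z, r z ≤ 1)
    (hr0 : ∀ z, 0 ≤ r z)
    (hcov : ∀ s t, P s → P t → |∫ ω, Z s ω * Z t ω ∂μ| ≤ r (s, t))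
    {V : ℝ} (hV0 : 0 ≤ V) (hV : ∫⁻ z, ENNReal.ofReal (r z) ∂(π.prod π) ≤ ENNReal.ofReal V)
    {l : ℝ} (hl : 0 ≤ l) :
    ∫⁻ z, ENNReal.ofReal (Real.exp (l * ((∫ s, |X s z.1| ^ p ∂π) ^ (1 / p)
        - (∫ s, |X s z.2| ^ p ∂π) ^ (1 / p)))) ∂(μ.prod μ)
      ≤ ENNReal.ofReal (Real.exp (l ^ 2 * (Real.pi ^ 2 * (2 * V) ^ (1 / p) / 8))) := by
  have hp0 : 0 < p := by linarith
  have hXs : ∀ s, Measurable (X s) := fun s ↦ hX.comp measurable_prodMk_left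
  set g : S × Ω → ℝ := fun z ↦ |X z.1 z.2| ^ p with hg
  have hgm : Measurable g := by fun_prop
  set C : ℝ := ∫ y, |y| ^ (2 * p) ∂(gaussianReal 0 1) + 1 with hC
  have hC0 : 0 < C := by
    have : 0 ≤ ∫ y, |y| ^ (2 * p) ∂(gaussianReal 0 1) := integral_nonneg fun y ↦ by positivity
    linarith
  have hgC : ∫⁻ z, ENNReal.ofReal (g z ^ 2) ∂(π.prod μ) ≤ ENNReal.ofReal C := by
    rw [lintegral_prod _ (by fun_prop)]
    calc ∫⁻ s, ∫⁻ ω, ENNReal.ofReal (g (s, ω) ^ 2) ∂μ ∂π ≤ ∫⁻ s, ENNReal.ofReal C ∂π := by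
          refine lintegral_mono_ae ?_
          filter_upwards [hP] with s hs
          have h1 : ∫⁻ ω, ENNReal.ofReal (g (s, ω) ^ 2) ∂μ
              = ∫⁻ y, ENNReal.ofReal (|y| ^ (2 * p)) ∂(gaussianReal 0 1) := by
            rw [← hlaw s, Measure.map_congr (hZX s hs), lintegral_map (by fun_prop) (hXs s)]
            refine lintegral_congr fun ω ↦ ?_
            rw [hg, mul_comm, Real.rpow_mul (abs_nonneg _)]
            norm_cast
          rw [h1, ← ofReal_integral_eq_lintegral_ofReal
            (integrable_abs_rpow_gaussianReal (by positivity))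
            (ae_of_all _ fun _ ↦ by positivity)]
          exact ENNReal.ofReal_le_ofReal (by linarith)
      _ = ENNReal.ofReal C := by simp
  have hsample : ∀ m : ℕ, ∃ x : Fin (m + 1) → S, (∀ i, P (x i)) ∧
      ∫⁻ ω, ENNReal.ofReal ((∑ i, ((m + 1 : ℕ) : ℝ)⁻¹ * g (x i, ω) - ∫ s, g (s, ω) ∂π) ^ 2) ∂μ
        ≤ ENNReal.ofReal (2 * C * ((m + 1 : ℕ) : ℝ)⁻¹) ∧
      ∑ i, ∑ j, (((m + 1 : ℕ) : ℝ)⁻¹) ^ 2 * r (x i, x j) ≤ 2 * (V + ((m + 1 : ℕ) : ℝ)⁻¹) :=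
    fun m ↦ exists_sample (Nat.succ_pos m) π μ hgm hC0 hgC hr hr0 hr1 hV0 hV hP
  choose x hxP hxg hxr using hsample
  set A : ℕ → Ω → ℝ := fun m ω ↦ ∑ i, ((m + 1 : ℕ) : ℝ)⁻¹ * g (x m i, ω) with hA
  set B : Ω → ℝ := fun ω ↦ ∫ s, |X s ω| ^ p ∂π with hB
  have hAm : ∀ m, Measurable (A m) := fun m ↦ by fun_prop
  have hBm : Measurable B := (hgm.stronglyMeasurable.integral_prod_left' (μ := π)).measurable
  have hinv : Tendsto (fun m : ℕ ↦ ((m + 1 : ℕ) : ℝ)⁻¹) atTop (𝓝 0) :=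
    tendsto_inv_atTop_nhds_zero_nat.comp (tendsto_add_atTop_nat 1)
  have hmeas : TendstoInMeasure μ A atTop B := by
    refine tendstoInMeasure_of_lintegral_sq hAm hBm ?_
    refine tendsto_of_tendsto_of_tendsto_of_le_of_le tendsto_const_nhds ?_ (fun _ ↦ zero_le)
      fun m ↦ hxg m
    have := ENNReal.tendsto_ofReal (hinv.const_mul (2 * C))
    simpa only [mul_zero, ENNReal.ofReal_zero] using this
  -- Empirical means converge in `L²`, hence almost surely along a subsequence; this suffices for
  -- Fatou's lemma below.
  obtain ⟨ns, hns, hae⟩ := hmeas.exists_seq_tendsto_ae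
  have hAp : ∀ m ω, powerMean p (fun i ↦ X (x m i) ω) = A m ω ^ (1 / p) := fun m ω ↦ by
    simp only [powerMean, Fintype.card_fin, hA, hg]
  have hbound : ∀ m, ∫⁻ z, ENNReal.ofReal (Real.exp (l * (A m z.1 ^ (1 / p) - A m z.2 ^ (1 / p))))
      ∂(μ.prod μ) ≤ ENNReal.ofReal (Real.exp (l ^ 2 * (Real.pi ^ 2 *
        (2 * (V + ((m + 1 : ℕ) : ℝ)⁻¹)) ^ (1 / p) / 8))) := by
    intro m
    have h1 := lintegral_exp_powerMean_process_le hZ (Nat.succ_pos m) (x := x m)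
      (fun i ↦ hXs _) (fun i ↦ hZX _ (hxP m i)) hmean hp
      (fun i j ↦ (hcov _ _ (hxP m i) (hxP m j)).trans (hr1 _)) hl
    simp only [hAp] at h1
    refine h1.trans (ENNReal.ofReal_le_ofReal (Real.exp_le_exp.2 ?_))
    gcongr
    refine le_trans ?_ (hxr m)
    gcongr with i _ j _
    exact hcov _ _ (hxP m i) (hxP m j)
  have hlimb : Tendsto (fun k ↦ ENNReal.ofReal (Real.exp (l ^ 2 * (Real.pi ^ 2 *
        (2 * (V + ((ns k + 1 : ℕ) : ℝ)⁻¹)) ^ (1 / p) / 8)))) atTop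
      (𝓝 (ENNReal.ofReal (Real.exp (l ^ 2 * (Real.pi ^ 2 * (2 * V) ^ (1 / p) / 8))))) := by
    have h1 : Tendsto (fun k ↦ 2 * (V + ((ns k + 1 : ℕ) : ℝ)⁻¹)) atTop (𝓝 (2 * V)) := by
      simpa only [add_zero, Function.comp_def] using
        ((hinv.comp hns.tendsto_atTop).const_add V).const_mul 2
    have h2 := h1.rpow_const (p := 1 / p) (Or.inr (by positivity))
    exact ENNReal.tendsto_ofReal ((Real.continuous_exp.tendsto _).comp
      (((h2.const_mul (Real.pi ^ 2)).div_const 8).const_mul (l ^ 2)))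
  have hconv : ∀ᵐ z ∂(μ.prod μ), Tendsto (fun k ↦ ENNReal.ofReal
      (Real.exp (l * (A (ns k) z.1 ^ (1 / p) - A (ns k) z.2 ^ (1 / p))))) atTop
      (𝓝 (ENNReal.ofReal (Real.exp (l * (B z.1 ^ (1 / p) - B z.2 ^ (1 / p)))))) := by
    filter_upwards [Measure.quasiMeasurePreserving_fst.ae hae,
      Measure.quasiMeasurePreserving_snd.ae hae] with z h1 h2
    have h1' := h1.rpow_const (p := 1 / p) (Or.inr (by positivity))
    have h2' := h2.rpow_const (p := 1 / p) (Or.inr (by positivity))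
    exact ENNReal.tendsto_ofReal ((Real.continuous_exp.tendsto _).comp ((h1'.sub h2').const_mul l))
  calc ∫⁻ z, ENNReal.ofReal (Real.exp (l * (B z.1 ^ (1 / p) - B z.2 ^ (1 / p)))) ∂(μ.prod μ)
      = ∫⁻ z, liminf (fun k ↦ ENNReal.ofReal
          (Real.exp (l * (A (ns k) z.1 ^ (1 / p) - A (ns k) z.2 ^ (1 / p))))) atTop ∂(μ.prod μ) := by
        refine lintegral_congr_ae ?_
        filter_upwards [hconv] with z hz
        exact hz.liminf_eq.symm
    _ ≤ liminf (fun k ↦ ∫⁻ z, ENNReal.ofReal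
          (Real.exp (l * (A (ns k) z.1 ^ (1 / p) - A (ns k) z.2 ^ (1 / p)))) ∂(μ.prod μ)) atTop :=
        lintegral_liminf_le fun k ↦ by fun_prop
    _ ≤ liminf (fun k ↦ ENNReal.ofReal (Real.exp (l ^ 2 * (Real.pi ^ 2 *
        (2 * (V + ((ns k + 1 : ℕ) : ℝ)⁻¹)) ^ (1 / p) / 8)))) atTop :=
        liminf_le_liminf (Eventually.of_forall fun k ↦ hbound (ns k))
    _ = _ := hlimb.liminf_eq

end GaussianProcessMean

/-! ### Concave variograms and the mean correlation of increments -/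

section Concave

variable {φ : ℝ → ℝ} {δ : ℝ}

theorem ConcaveOn.div_mul_le_of_zero (hc : ConcaveOn ℝ (Set.Icc 0 δ) φ) (h0 : φ 0 = 0) {x y : ℝ}
    (hx : 0 ≤ x) (hxy : x ≤ y) (hy0 : 0 < y) (hy : y ≤ δ) : x / y * φ y ≤ φ x := by
  have h1 : x / y ≤ 1 := (div_le_one hy0).2 hxy
  have hy_mem : y ∈ Set.Icc 0 δ := ⟨hy0.le, hy⟩
  have hz_mem : (0 : ℝ) ∈ Set.Icc 0 δ := ⟨le_rfl, hy0.le.trans hy⟩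
  have h2 : 0 ≤ x / y := by positivity
  have h := hc.2 hy_mem hz_mem h2 (by linarith : 0 ≤ 1 - x / y) (by ring)
  simp only [smul_eq_mul, h0, mul_zero, add_zero] at h
  rwa [div_mul_cancel₀ x hy0.ne'] at h

theorem ConcaveOn.subadditive_of_zero (hc : ConcaveOn ℝ (Set.Icc 0 δ) φ) (h0 : φ 0 = 0) {x y : ℝ}
    (hx : 0 ≤ x) (hy : 0 < y) (hxy : x + y ≤ δ) : φ (x + y) ≤ φ x + φ y := by
  have h1 := hc.div_mul_le_of_zero h0 hx (by linarith : x ≤ x + y) (by linarith) hxy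
  have h2 := hc.div_mul_le_of_zero h0 hy.le (by linarith : y ≤ x + y) (by linarith) hxy
  have h3 : x / (x + y) * φ (x + y) + y / (x + y) * φ (x + y) = φ (x + y) := by
    have : x + y ≠ 0 := by linarith
    field_simp
  linarith

theorem ConcaveOn.add_le_two_mul (hc : ConcaveOn ℝ (Set.Icc 0 δ) φ) {u h : ℝ} (hh : 0 ≤ h)
    (hu : h ≤ u) (huδ : u + h ≤ δ) : φ (u + h) + φ (u - h) ≤ 2 * φ u := by
  have h1 : u + h ∈ Set.Icc 0 δ := ⟨by linarith, huδ⟩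
  have h2 : u - h ∈ Set.Icc 0 δ := ⟨by linarith, by linarith⟩
  have h3 := hc.2 h1 h2 (by norm_num : (0 : ℝ) ≤ 1 / 2) (by norm_num : (0 : ℝ) ≤ 1 / 2)
    (by norm_num)
  simp only [smul_eq_mul] at h3
  rw [show 1 / 2 * (u + h) + 1 / 2 * (u - h) = u by ring] at h3
  linarith

/-- The extension of a function on `[0, δ]` by constants. -/
noncomputable def clampExtend (φ : ℝ → ℝ) (δ v : ℝ) : ℝ := φ (max 0 (min v δ))

theorem clampExtend_of_mem {v : ℝ} (h0 : 0 ≤ v) (hv : v ≤ δ) : clampExtend φ δ v = φ v := by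
  rw [clampExtend, min_eq_left hv, max_eq_right h0]

theorem MonotoneOn.monotone_clampExtend (hm : MonotoneOn φ (Set.Icc 0 δ)) (hδ : 0 ≤ δ) :
    Monotone (clampExtend φ δ) := by
  intro x y hxy
  refine hm ⟨le_max_left _ _, max_le hδ (min_le_right _ _)⟩
    ⟨le_max_left _ _, max_le hδ (min_le_right _ _)⟩ ?_
  gcongr

/-- The correlation `(φ(u + h) + φ(u - h) - 2 φ(u)) / (2 φ(h))` of two increments of length `h`
at distance `u`, for a variogram `φ` which is only considered on `[-δ, δ]`. -/
noncomputable def incrementCorr (φ : ℝ → ℝ) (δ h u : ℝ) : ℝ :=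
  (clampExtend φ δ |u + h| + clampExtend φ δ |u - h| - 2 * clampExtend φ δ |u|) / (2 * φ h)

theorem incrementCorr_neg (h u : ℝ) : incrementCorr φ δ h (-u) = incrementCorr φ δ h u := by
  unfold incrementCorr
  rw [abs_neg, show -u + h = -(u - h) by ring, show -u - h = -(u + h) by ring, abs_neg, abs_neg,
    add_comm (clampExtend φ δ |u - h|)]

theorem measurable_incrementCorr (hm : MonotoneOn φ (Set.Icc 0 δ)) (hδ : 0 ≤ δ) (h : ℝ) :
    Measurable (incrementCorr φ δ h) := by
  have := (hm.monotone_clampExtend hδ).measurable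
  unfold incrementCorr
  fun_prop

/-- After translation everything cancels except near the two ends. The integral of `ψ(u) - ψ(u - h)`
over `[h, 2h]` is at most `h φ(h)` by subadditivity; that of `ψ(u) - ψ(u + h)` over `[L - h, L]` is
nonpositive by monotonicity. -/
theorem integral_second_difference_le (hc : ConcaveOn ℝ (Set.Icc 0 δ) φ)
    (hm : MonotoneOn φ (Set.Icc 0 δ)) (h0 : φ 0 = 0) {h L : ℝ} (hh : 0 < h) (hhL : h ≤ L)
    (hL : L + h ≤ δ) :
    ∫ u in h..L, (2 * clampExtend φ δ u - clampExtend φ δ (u + h) - clampExtend φ δ (u - h))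
      ≤ h * φ h := by
  have hmono := hm.monotone_clampExtend (by linarith)
  set ψ := clampExtend φ δ with hψ
  have hii : ∀ a b : ℝ, IntervalIntegrable ψ volume a b := fun a b ↦ hmono.intervalIntegrable
  have hip : ∀ a b c : ℝ, IntervalIntegrable (fun u ↦ ψ (u + c)) volume a b := fun a b c ↦
    Monotone.intervalIntegrable fun x y hxy ↦ hmono (by linarith)
  have him : ∀ a b c : ℝ, IntervalIntegrable (fun u ↦ ψ (u - c)) volume a b := fun a b c ↦
    Monotone.intervalIntegrable fun x y hxy ↦ hmono (by linarith)
  have e1 : ∫ u in h..L, (2 * ψ u - ψ (u + h) - ψ (u - h))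
      = 2 * (∫ u in h..L, ψ u) - (∫ u in (h + h)..(L + h), ψ u) - ∫ u in (0 : ℝ)..(L - h), ψ u := by
    rw [intervalIntegral.integral_sub (((hii _ _).const_mul 2).sub (hip _ _ _)) (him _ _ _),
      intervalIntegral.integral_sub ((hii _ _).const_mul 2) (hip _ _ _),
      intervalIntegral.integral_const_mul, intervalIntegral.integral_comp_add_right,
      intervalIntegral.integral_comp_sub_right, sub_self]
  have e2 : ∫ u in h..(h + h), (ψ u - ψ (u - h)) = (∫ u in h..(h + h), ψ u) - ∫ u in (0 : ℝ)..h, ψ u := by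
    rw [intervalIntegral.integral_sub (hii _ _) (him _ _ _),
      intervalIntegral.integral_comp_sub_right, sub_self, add_sub_cancel_right]
  have e3 : ∫ u in (L - h)..L, (ψ u - ψ (u + h))
      = (∫ u in (L - h)..L, ψ u) - ∫ u in L..(L + h), ψ u := by
    rw [intervalIntegral.integral_sub (hii _ _) (hip _ _ _),
      intervalIntegral.integral_comp_add_right, sub_add_cancel]
  have a1 := intervalIntegral.integral_add_adjacent_intervals (hii 0 h) (hii h L)
  have a2 := intervalIntegral.integral_add_adjacent_intervals (hii 0 (L - h)) (hii (L - h) L)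
  have a3 := intervalIntegral.integral_add_adjacent_intervals (hii h (h + h)) (hii (h + h) (L + h))
  have a4 := intervalIntegral.integral_add_adjacent_intervals (hii h L) (hii L (L + h))
  have b1 : ∫ u in (L - h)..L, (ψ u - ψ (u + h)) ≤ 0 := by
    have : 0 ≤ ∫ u in (L - h)..L, (ψ (u + h) - ψ u) :=
      intervalIntegral.integral_nonneg (by linarith) fun u _ ↦ by
        have := hmono (show u ≤ u + h by linarith)
        linarith
    have e : ∀ u, ψ u - ψ (u + h) = -(ψ (u + h) - ψ u) := fun u ↦ by ring
    simp only [e, intervalIntegral.integral_neg]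
    linarith
  have b2 : ∫ u in h..(h + h), (ψ u - ψ (u - h)) ≤ ∫ _u in h..(h + h), φ h := by
    refine intervalIntegral.integral_mono_on (by linarith) ((hii _ _).sub (him _ _ _))
      intervalIntegrable_const fun u hu ↦ ?_
    have := hc.subadditive_of_zero h0 (x := u - h) (y := h) (by linarith [hu.1]) hh
      (by linarith [hu.2])
    rw [sub_add_cancel] at this
    rw [hψ, clampExtend_of_mem (by linarith [hu.1]) (by linarith [hu.2]),
      clampExtend_of_mem (by linarith [hu.1]) (by linarith [hu.2])]
    linarith
  rw [intervalIntegral.integral_const, smul_eq_mul, add_sub_cancel_right] at b2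
  rw [e1]
  linarith

/-- For `|u| ≤ h` the bound `1` contributes `2 h`. For `h < |u| ≤ L` concavity fixes the sign of the
correlation, so its absolute value integrates like the second difference: `h φ(h) / (2 φ(h)) = h /
2` on each side. The factor `φ(h)` cancels, so no lower bound on `σ` enters. -/
theorem lintegral_incrementCorr_le (hc : ConcaveOn ℝ (Set.Icc 0 δ) φ)
    (hm : MonotoneOn φ (Set.Icc 0 δ)) (h0 : φ 0 = 0) {h L : ℝ} (hh : 0 < h) (hhL : h ≤ L)
    (hL : L + h ≤ δ) (hφ : 0 < φ h) :
    ∫⁻ u in Set.Icc (-L) L, ENNReal.ofReal (min 1 |incrementCorr φ δ h u|) ≤ ENNReal.ofReal (3 * h) := by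
  have hδ : 0 ≤ δ := by linarith
  have hmono := hm.monotone_clampExtend hδ
  have hcm := measurable_incrementCorr hm hδ h
  set k : ℝ → ENNReal := fun u ↦ ENNReal.ofReal (min 1 |incrementCorr φ δ h u|) with hk
  have hright : ∫⁻ u in Set.Ioc h L, k u ≤ ENNReal.ofReal (h / 2) := by
    set q : ℝ → ℝ := fun u ↦ (2 * clampExtend φ δ u - clampExtend φ δ (u + h)
      - clampExtend φ δ (u - h)) / (2 * φ h) with hq
    have hii : IntervalIntegrable q volume h L := by
      refine IntervalIntegrable.div_const (((hmono.intervalIntegrable.const_mul 2).sub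
        (Monotone.intervalIntegrable fun x y hxy ↦ hmono (by linarith))).sub
        (Monotone.intervalIntegrable fun x y hxy ↦ hmono (by linarith))) _
    have hq0 : ∀ u ∈ Set.Ioc h L, 0 ≤ q u ∧ |incrementCorr φ δ h u| = q u := by
      intro u hu
      have h1 := hc.add_le_two_mul hh.le hu.1.le (by linarith [hu.2])
      have hqu : 0 ≤ q u := by
        simp only [hq]
        rw [clampExtend_of_mem (by linarith [hu.1]) (by linarith [hu.2]),
          clampExtend_of_mem (by linarith [hu.1]) (by linarith [hu.2]),
          clampExtend_of_mem (by linarith [hu.1]) (by linarith [hu.2])]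
        refine div_nonneg ?_ (by positivity)
        linarith
      refine ⟨hqu, ?_⟩
      have : incrementCorr φ δ h u = - q u := by
        simp only [hq, incrementCorr]
        rw [abs_of_nonneg (by linarith [hu.1] : 0 ≤ u + h),
          abs_of_nonneg (by linarith [hu.1] : 0 ≤ u - h),
          abs_of_nonneg (by linarith [hu.1] : 0 ≤ u)]
        ring
      rw [this, abs_neg, abs_of_nonneg hqu]
    calc ∫⁻ u in Set.Ioc h L, k u ≤ ∫⁻ u in Set.Ioc h L, ENNReal.ofReal (q u) := by
          refine setLIntegral_mono_ae' measurableSet_Ioc (ae_of_all _ fun u hu ↦ ?_)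
          rw [hk, ← (hq0 u hu).2]
          exact ENNReal.ofReal_le_ofReal (min_le_right _ _)
      _ = ENNReal.ofReal (∫ u in Set.Ioc h L, q u) := by
          rw [ofReal_integral_eq_lintegral_ofReal hii.1]
          filter_upwards [ae_restrict_mem measurableSet_Ioc] with u hu using (hq0 u hu).1
      _ ≤ _ := by
          refine ENNReal.ofReal_le_ofReal ?_
          rw [← intervalIntegral.integral_of_le hhL]
          simp only [hq, intervalIntegral.integral_div]
          rw [div_le_div_iff₀ (by positivity) two_pos]
          have := integral_second_difference_le hc hm h0 hh hhL hL
          linarith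
  have hleft : ∫⁻ u in Set.Ico (-L) (-h), k u = ∫⁻ u in Set.Ioc h L, k u := by
    rw [← lintegral_indicator measurableSet_Ico, ← lintegral_indicator measurableSet_Ioc,
      ← lintegral_neg_eq_self]
    refine lintegral_congr fun u ↦ ?_
    have hku : k (-u) = k u := by simp only [hk, incrementCorr_neg]
    simp only [Set.indicator_apply, hku, Set.mem_Ico, Set.mem_Ioc, neg_le_neg_iff, neg_lt_neg_iff,
      and_comm]
  have hmid : ∫⁻ u in Set.Icc (-h) h, k u ≤ ENNReal.ofReal (2 * h) := by
    calc _ ≤ ∫⁻ u in Set.Icc (-h) h, 1 := by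
          refine lintegral_mono fun u ↦ ?_
          simp [hk]
      _ = _ := by
          rw [setLIntegral_const, one_mul, Real.volume_Icc]
          ring_nf
  have hsub : Set.Icc (-L) L ⊆ Set.Ico (-L) (-h) ∪ (Set.Icc (-h) h ∪ Set.Ioc h L) := by
    intro u hu
    simp only [Set.mem_union, Set.mem_Ico, Set.mem_Icc, Set.mem_Ioc]
    rcases lt_or_ge u (-h) with h1 | h1
    · exact Or.inl ⟨hu.1, h1⟩
    rcases le_or_gt u h with h2 | h2
    · exact Or.inr (Or.inl ⟨h1, h2⟩)
    · exact Or.inr (Or.inr ⟨h2, hu.2⟩)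
  calc ∫⁻ u in Set.Icc (-L) L, k u
      ≤ ∫⁻ u in Set.Ico (-L) (-h) ∪ (Set.Icc (-h) h ∪ Set.Ioc h L), k u := lintegral_mono_set hsub
    _ ≤ (∫⁻ u in Set.Ico (-L) (-h), k u)
        + ((∫⁻ u in Set.Icc (-h) h, k u) + ∫⁻ u in Set.Ioc h L, k u) :=
        (lintegral_union_le _ _ _).trans (by gcongr; exact lintegral_union_le _ _ _)
    _ ≤ ENNReal.ofReal (h / 2) + (ENNReal.ofReal (2 * h) + ENNReal.ofReal (h / 2)) := by
        rw [hleft]; gcongr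
    _ = _ := by
        rw [← ENNReal.ofReal_add (by positivity) (by positivity),
          ← ENNReal.ofReal_add (by positivity) (by positivity)]
        ring_nf

/-- The uniform probability measure on `(a, b]`. -/
noncomputable def uniformIoc (a b : ℝ) : Measure ℝ :=
  ENNReal.ofReal (b - a)⁻¹ • volume.restrict (Set.Ioc a b)

theorem isProbabilityMeasure_uniformIoc {a b : ℝ} (hab : a < b) :
    IsProbabilityMeasure (uniformIoc a b) := by
  have : 0 < b - a := sub_pos.2 hab
  constructor
  rw [uniformIoc, Measure.smul_apply, Measure.restrict_apply_univ, Real.volume_Ioc, smul_eq_mul,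
    ← ENNReal.ofReal_mul (by positivity), inv_mul_cancel₀ this.ne', ENNReal.ofReal_one]

theorem integral_uniformIoc {a b : ℝ} (hab : a < b) (f : ℝ → ℝ) :
    ∫ x, f x ∂(uniformIoc a b) = (b - a)⁻¹ * ∫ x in a..b, f x := by
  have : 0 < b - a := sub_pos.2 hab
  rw [uniformIoc, integral_smul_measure, ENNReal.toReal_ofReal (by positivity),
    intervalIntegral.integral_of_le hab.le, smul_eq_mul]

theorem ae_uniformIoc {a b : ℝ} {P : ℝ → Prop} (h : ∀ᵐ x, P x) :
    ∀ᵐ x ∂(uniformIoc a b), x ∈ Set.Ioc a b ∧ P x :=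
  Measure.ae_smul_measure ((ae_restrict_mem measurableSet_Ioc).and (ae_restrict_of_ae h)) _

/-- For fixed `x` in `(a, b]` the difference `x - y` stays in `[-(b - a), b - a]`, and the
one-variable bound applies with `L = b - a`. -/
theorem lintegral_pair_incrementCorr_le (hc : ConcaveOn ℝ (Set.Icc 0 δ) φ)
    (hm : MonotoneOn φ (Set.Icc 0 δ)) (h0 : φ 0 = 0) {a b h : ℝ} (hab : a < b) (hh : 0 < h)
    (hhL : h ≤ b - a) (hL : b - a + h ≤ δ) (hφ : 0 < φ h) :
    ∫⁻ z, ENNReal.ofReal (min 1 |incrementCorr φ δ h (z.1 - z.2)|)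
        ∂((uniformIoc a b).prod (uniformIoc a b)) ≤ ENNReal.ofReal (3 * h / (b - a)) := by
  have hδ : 0 ≤ δ := by linarith
  have hL0 : 0 < b - a := sub_pos.2 hab
  have := isProbabilityMeasure_uniformIoc hab
  have hcm := measurable_incrementCorr hm hδ h
  set k : ℝ → ENNReal := fun u ↦ ENNReal.ofReal (min 1 |incrementCorr φ δ h u|) with hk
  have hkm : Measurable k := by fun_prop
  rw [lintegral_prod _ (by fun_prop)]
  calc ∫⁻ x, ∫⁻ y, k (x - y) ∂(uniformIoc a b) ∂(uniformIoc a b)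
      ≤ ∫⁻ x, ENNReal.ofReal (3 * h / (b - a)) ∂(uniformIoc a b) := by
        refine lintegral_mono_ae ?_
        filter_upwards [ae_uniformIoc (P := fun _ ↦ True) (ae_of_all _ fun _ ↦ trivial)] with x hx
        rw [uniformIoc, lintegral_smul_measure, smul_eq_mul]
        calc _ ≤ ENNReal.ofReal (b - a)⁻¹ * ENNReal.ofReal (3 * h) := by
              gcongr
              refine le_trans ?_ (lintegral_incrementCorr_le hc hm h0 hh hhL hL hφ)
              rw [← lintegral_indicator measurableSet_Ioc, ← lintegral_indicator measurableSet_Icc]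
              conv_rhs => rw [← lintegral_sub_left_eq_self _ x]
              refine lintegral_mono fun y ↦ ?_
              by_cases hy : y ∈ Set.Ioc a b
              · have : x - y ∈ Set.Icc (-(b - a)) (b - a) :=
                  ⟨by linarith [hx.1.1, hy.2], by linarith [hx.1.2, hy.1]⟩
                rw [Set.indicator_of_mem hy, Set.indicator_of_mem this]
              · rw [Set.indicator_of_notMem hy]
                exact zero_le
          _ = _ := by
              rw [← ENNReal.ofReal_mul (by positivity)]
              congr 1
              field_simp
    _ = _ := by simp

end Concave

/-! ### Covariances of standardized increments -/

section Increments

variable {Ω : Type*} [MeasurableSpace Ω] {G : ℝ → Ω → ℝ} {μ : Measure Ω}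

theorem incrementVariance_zero : incrementVariance G μ 0 = 0 := by
  simp [incrementVariance]

theorem incrementVariance_nonneg (h : ℝ) : 0 ≤ incrementVariance G μ h :=
  integral_nonneg fun _ ↦ sq_nonneg _

theorem HasStationaryIncrements.integral_sq_sub (hG : HasStationaryIncrements G μ) (x y : ℝ) :
    ∫ ω, (G x ω - G y ω) ^ 2 ∂μ = incrementVariance G μ (x - y) := by
  rw [← hG.integral_sq_increment y (x - y), add_sub_cancel]

theorem HasStationaryIncrements.incrementVariance_neg (hG : HasStationaryIncrements G μ) (h : ℝ) :
    incrementVariance G μ (-h) = incrementVariance G μ h := by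
  have h1 := hG.integral_sq_sub 0 h
  have h2 := hG.integral_sq_sub h 0
  rw [zero_sub] at h1
  rw [sub_zero] at h2
  rw [← h1, ← h2]
  exact integral_congr_ae (ae_of_all _ fun ω ↦ by ring)

theorem HasStationaryIncrements.incrementVariance_abs (hG : HasStationaryIncrements G μ) (h : ℝ) :
    incrementVariance G μ |h| = incrementVariance G μ h := by
  rcases abs_choice h with e | e <;> rw [e]
  exact hG.incrementVariance_neg h

/-- The standardized increments `(G(x + h) - G(x)) / σ(h)`. -/
noncomputable def stdIncrement (G : ℝ → Ω → ℝ) (μ : Measure Ω) (h x : ℝ) (ω : Ω) : ℝ :=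
  (G (x + h) ω - G x ω) / incrementStd G μ h

theorem incrementStd_sq (h : ℝ) : incrementStd G μ h ^ 2 = incrementVariance G μ h :=
  Real.sq_sqrt (incrementVariance_nonneg h)

theorem isGaussianProcess_stdIncrement (hG : IsGaussianProcess G μ) (h : ℝ) :
    IsGaussianProcess (stdIncrement G μ h) μ := by
  classical
  refine hG.of_isGaussianProcess fun x ↦ ⟨{x + h, x},
    (incrementStd G μ h)⁻¹ • (ContinuousLinearMap.proj (R := ℝ)
      (φ := fun _ : ({x + h, x} : Finset ℝ) ↦ ℝ) ⟨x + h, by simp⟩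
      - ContinuousLinearMap.proj (R := ℝ)
        (φ := fun _ : ({x + h, x} : Finset ℝ) ↦ ℝ) ⟨x, by simp⟩), fun ω ↦ ?_⟩
  simp [stdIncrement, div_eq_inv_mul]

theorem integral_stdIncrement (hG : IsGaussianProcess G μ) (hmean : ∀ x, ∫ ω, G x ω ∂μ = 0)
    (h x : ℝ) : ∫ ω, stdIncrement G μ h x ω ∂μ = 0 := by
  simp only [stdIncrement, integral_div]
  rw [integral_sub (hG.hasGaussianLaw_eval _).integrable (hG.hasGaussianLaw_eval _).integrable,
    hmean, hmean, sub_self, zero_div]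

theorem integral_sq_stdIncrement (hstat : HasStationaryIncrements G μ) {h : ℝ}
    (hh : 0 < incrementVariance G μ h) (x : ℝ) : ∫ ω, stdIncrement G μ h x ω ^ 2 ∂μ = 1 := by
  simp only [stdIncrement, div_pow, integral_div]
  rw [hstat.integral_sq_increment, incrementStd_sq, div_self hh.ne']

theorem map_stdIncrement (hG : IsGaussianProcess G μ) (hmean : ∀ x, ∫ ω, G x ω ∂μ = 0)
    (hstat : HasStationaryIncrements G μ) {h : ℝ} (hh : 0 < incrementVariance G μ h) (x : ℝ) :
    μ.map (stdIncrement G μ h x) = gaussianReal 0 1 := by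
  have hg := (isGaussianProcess_stdIncrement hG h).hasGaussianLaw_eval x
  rw [hg.map_eq_gaussianReal, integral_stdIncrement hG hmean,
    variance_of_integral_eq_zero hg.aemeasurable (integral_stdIncrement hG hmean h x),
    integral_sq_stdIncrement hstat hh, Real.toNNReal_one]

/-- Polarization: the product of two increments is half a signed sum of four squared increments,
each with expectation given by the variogram. -/
theorem integral_stdIncrement_mul (hG : IsGaussianProcess G μ)
    (hstat : HasStationaryIncrements G μ) (h x y : ℝ) :
    ∫ ω, stdIncrement G μ h x ω * stdIncrement G μ h y ω ∂μ
      = (incrementVariance G μ (x - y + h) + incrementVariance G μ (x - y - h)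
        - 2 * incrementVariance G μ (x - y)) / (2 * incrementVariance G μ h) := by
  have hint : ∀ s t, Integrable (fun ω ↦ (G s ω - G t ω) ^ 2) μ := fun s t ↦
    (hG.hasGaussianLaw_fun_sub (s := s) (t := t)).memLp_two.integrable_sq
  have e : ∀ ω, stdIncrement G μ h x ω * stdIncrement G μ h y ω
      = ((G (x + h) ω - G y ω) ^ 2 + (G x ω - G (y + h) ω) ^ 2
        + ((-1) * (G (x + h) ω - G (y + h) ω) ^ 2 + (-1) * (G x ω - G y ω) ^ 2)) / (2 * incrementVariance G μ h) := by
    intro ω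
    rw [stdIncrement, stdIncrement, div_mul_div_comm, ← sq, incrementStd_sq, ← div_div]
    congr 1
    ring
  simp only [e, integral_div]
  rw [integral_add ((hint _ _).fun_add (hint _ _))
      (((hint _ _).const_mul _).fun_add ((hint _ _).const_mul _)),
    integral_add (hint _ _) (hint _ _),
    integral_add ((hint _ _).const_mul _) ((hint _ _).const_mul _)]
  simp only [integral_const_mul]
  simp only [hstat.integral_sq_sub]
  rw [show x + h - y = x - y + h by ring, show x - (y + h) = x - y - h by ring,
    show x + h - (y + h) = x - y by ring]
  congr 1
  ring

theorem abs_integral_stdIncrement_mul_le (hG : IsGaussianProcess G μ)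
    (hstat : HasStationaryIncrements G μ) {h : ℝ} (hh : 0 < incrementVariance G μ h) (x y : ℝ) :
    |∫ ω, stdIncrement G μ h x ω * stdIncrement G μ h y ω ∂μ| ≤ 1 := by
  have hZ := isGaussianProcess_stdIncrement hG h
  have hsq : ∀ s, Integrable (fun ω ↦ stdIncrement G μ h s ω ^ 2) μ := fun s ↦
    (hZ.hasGaussianLaw_eval s).memLp_two.integrable_sq
  calc _ ≤ ∫ ω, |stdIncrement G μ h x ω * stdIncrement G μ h y ω| ∂μ := abs_integral_le_integral_abs
    _ ≤ ∫ ω, (stdIncrement G μ h x ω ^ 2 + stdIncrement G μ h y ω ^ 2) / 2 ∂μ := by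
        refine integral_mono_of_nonneg (ae_of_all _ fun _ ↦ abs_nonneg _)
          (((hsq x).add (hsq y)).div_const 2) (ae_of_all _ fun ω ↦ ?_)
        have h1 := two_mul_le_add_sq |stdIncrement G μ h x ω| |stdIncrement G μ h y ω|
        simp only [sq_abs] at h1
        simp only [abs_mul]
        linarith
    _ = 1 := by
        rw [integral_div, integral_add (hsq x) (hsq y), integral_sq_stdIncrement hstat hh,
          integral_sq_stdIncrement hstat hh]
        norm_num

/-- The condition `b - a + h ≤ δ` keeps `x - y` and `x - y ± h` in `[-δ, δ]`, where the clamped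
variogram is the true one. -/
theorem abs_integral_stdIncrement_mul_le_corr (hG : IsGaussianProcess G μ)
    (hstat : HasStationaryIncrements G μ) {δ a b h : ℝ} (hh0 : 0 ≤ h)
    (hh : 0 < incrementVariance G μ h) (hL : b - a + h ≤ δ) {x y : ℝ} (hx : x ∈ Set.Ioc a b)
    (hy : y ∈ Set.Ioc a b) :
    |∫ ω, stdIncrement G μ h x ω * stdIncrement G μ h y ω ∂μ|
      ≤ min 1 |incrementCorr (incrementVariance G μ) δ h (x - y)| := by
  refine le_min (abs_integral_stdIncrement_mul_le hG hstat hh x y) (le_of_eq ?_)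
  have hu : |x - y| ≤ b - a := abs_le.2 ⟨by linarith [hx.1, hy.2], by linarith [hx.2, hy.1]⟩
  have e : ∀ u, |u| ≤ δ →
      clampExtend (incrementVariance G μ) δ |u| = incrementVariance G μ u := fun u hu ↦ by
    rw [clampExtend_of_mem (abs_nonneg _) hu, hstat.incrementVariance_abs]
  rw [integral_stdIncrement_mul hG hstat, incrementCorr, e, e, e]
  · linarith
  · exact (abs_sub _ _).trans (by rw [abs_of_nonneg hh0]; linarith)
  · exact (abs_add_le _ _).trans (by rw [abs_of_nonneg hh0]; linarith)

end Increments

/-! ### From sub-Gaussian differences to almost sure convergence -/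

section Concentration

variable {Ω : Type*} [MeasurableSpace Ω] {μ : Measure Ω} [IsProbabilityMeasure μ]

/-- The symmetric form of a sub-Gaussian bound for the difference of two independent copies. -/
theorem measure_le_abs_sub_le {F : Ω → ℝ} (hF : Measurable F) {s : ℝ} (hs : 0 < s)
    (hexp : ∀ l, 0 ≤ l → ∫⁻ z, ENNReal.ofReal (Real.exp (l * (F z.1 - F z.2))) ∂(μ.prod μ)
      ≤ ENNReal.ofReal (Real.exp (l ^ 2 * s))) {ε : ℝ} (hε : 0 ≤ ε) :
    (μ.prod μ) {z | ε ≤ |F z.1 - F z.2|}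
      ≤ 2 * ENNReal.ofReal (Real.exp (-(ε ^ 2 / (4 * s)))) := by
  have h1 : (μ.prod μ) {z | ε ≤ F z.1 - F z.2} ≤ ENNReal.ofReal (Real.exp (-(ε ^ 2 / (4 * s)))) := by
    -- This is the minimizer of `l² s - l ε`, with minimum `-ε² / (4 s)`.
    set l := ε / (2 * s) with hl
    have hl0 : 0 ≤ l := by positivity
    have hm := mul_meas_ge_le_lintegral (μ := μ.prod μ)
      (f := fun z ↦ ENNReal.ofReal (Real.exp (l * (F z.1 - F z.2)))) (by fun_prop)
      (ENNReal.ofReal (Real.exp (l * ε)))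
    have hsub : {z : Ω × Ω | ε ≤ F z.1 - F z.2} ⊆ {z | ENNReal.ofReal (Real.exp (l * ε))
        ≤ ENNReal.ofReal (Real.exp (l * (F z.1 - F z.2)))} := by
      intro z hz
      exact ENNReal.ofReal_le_ofReal (Real.exp_le_exp.2 (mul_le_mul_of_nonneg_left hz hl0))
    calc (μ.prod μ) {z | ε ≤ F z.1 - F z.2}
        = ENNReal.ofReal (Real.exp (-(l * ε))) * (ENNReal.ofReal (Real.exp (l * ε))
          * (μ.prod μ) {z | ε ≤ F z.1 - F z.2}) := by
          rw [← mul_assoc, ← ENNReal.ofReal_mul (Real.exp_pos _).le, ← Real.exp_add,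
            neg_add_cancel, Real.exp_zero, ENNReal.ofReal_one, one_mul]
      _ ≤ ENNReal.ofReal (Real.exp (-(l * ε))) * ENNReal.ofReal (Real.exp (l ^ 2 * s)) := by
          gcongr
          exact (mul_le_mul_right (measure_mono hsub) _).trans (hm.trans (hexp l hl0))
      _ = _ := by
          rw [← ENNReal.ofReal_mul (Real.exp_pos _).le, ← Real.exp_add, hl]
          congr 2
          field_simp
          ring
  have h2 : (μ.prod μ) {z | ε ≤ F z.2 - F z.1} = (μ.prod μ) {z | ε ≤ F z.1 - F z.2} := by
    have hset : MeasurableSet {z : Ω × Ω | ε ≤ F z.1 - F z.2} :=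
      measurableSet_le measurable_const (by fun_prop)
    conv_rhs => rw [← Measure.prod_swap, Measure.map_apply measurable_swap hset]
    rfl
  have hsub : {z : Ω × Ω | ε ≤ |F z.1 - F z.2|}
      ⊆ {z | ε ≤ F z.1 - F z.2} ∪ {z | ε ≤ F z.2 - F z.1} := by
    intro z hz
    rcases le_abs.1 hz.out with h | h
    · exact Or.inl h
    · exact Or.inr (by simpa using h)
  refine (measure_mono hsub).trans ((measure_union_le _ _).trans ?_)
  rw [h2, two_mul]
  gcongr

/-- The elementary bound of `|y| ^ p` by `(p / t) ^ p * exp (t |y|)` is used with `t = 1 / √s`,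
which turns the exponential moment bound into the constant `exp 1`. -/
theorem lintegral_abs_sub_rpow_le {F : Ω → ℝ} (hF : Measurable F) {s : ℝ} (hs : 0 < s)
    (hexp : ∀ l, 0 ≤ l → ∫⁻ z, ENNReal.ofReal (Real.exp (l * (F z.1 - F z.2))) ∂(μ.prod μ)
      ≤ ENNReal.ofReal (Real.exp (l ^ 2 * s))) {p : ℝ} (hp : 0 < p) :
    ∫⁻ z, ENNReal.ofReal (|F z.1 - F z.2| ^ p) ∂(μ.prod μ)
      ≤ ENNReal.ofReal ((p * √s) ^ p * (2 * Real.exp 1)) := by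
  set t := (√s)⁻¹ with ht
  have hs' : 0 < √s := Real.sqrt_pos.2 hs
  have ht0 : 0 < t := by positivity
  have hts : t ^ 2 * s = 1 := by
    rw [ht, inv_pow, Real.sq_sqrt hs.le, inv_mul_cancel₀ hs.ne']
  have hpt : ∀ y : ℝ, |y| ^ p ≤ (p * √s) ^ p * (Real.exp (t * y) + Real.exp (t * (-y))) := by
    intro y
    have h := rpow_abs_le_mul_exp_abs y hp.le ht0.ne'
    rw [abs_of_pos ht0] at h
    have e : p / t = p * √s := by rw [ht]; field_simp
    rw [e] at h
    refine h.trans (mul_le_mul_of_nonneg_left ?_ (by positivity))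
    rcases abs_choice y with e | e <;> rw [e]
    · exact le_add_of_nonneg_right (Real.exp_pos _).le
    · exact le_add_of_nonneg_left (Real.exp_pos _).le
  have h1 := hexp t ht0.le
  rw [hts] at h1
  have h2 : ∫⁻ z, ENNReal.ofReal (Real.exp (t * (-(F z.1 - F z.2)))) ∂(μ.prod μ)
      ≤ ENNReal.ofReal (Real.exp 1) := by
    refine le_trans (le_of_eq ?_) h1
    conv_rhs => rw [← Measure.prod_swap, lintegral_map (by fun_prop) measurable_swap]
    simp only [Prod.fst_swap, Prod.snd_swap, neg_sub]
  calc _ ≤ ∫⁻ z, ENNReal.ofReal ((p * √s) ^ p) * (ENNReal.ofReal (Real.exp (t * (F z.1 - F z.2)))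
          + ENNReal.ofReal (Real.exp (t * (-(F z.1 - F z.2))))) ∂(μ.prod μ) := by
        refine lintegral_mono fun z ↦ ?_
        rw [← ENNReal.ofReal_add (Real.exp_pos _).le (Real.exp_pos _).le,
          ← ENNReal.ofReal_mul (by positivity)]
        exact ENNReal.ofReal_le_ofReal (hpt _)
    _ ≤ ENNReal.ofReal ((p * √s) ^ p) * (ENNReal.ofReal (Real.exp 1)
          + ENNReal.ofReal (Real.exp 1)) := by
        rw [lintegral_const_mul _ (by fun_prop), lintegral_add_left (by fun_prop)]
        gcongr
    _ = _ := by
        rw [← ENNReal.ofReal_add (Real.exp_pos _).le (Real.exp_pos _).le,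
          ← ENNReal.ofReal_mul (by positivity), two_mul]

/-- The distance of a constant to the `L^p` norm is at most the `L^p` distance. -/
theorem ofReal_abs_sub_rpow_le_lintegral {F : Ω → ℝ} (hF : Measurable F) (hF0 : ∀ ω, 0 ≤ F ω)
    {p c : ℝ} (hp : 1 ≤ p) (hc : 0 ≤ c)
    (hFc : ∫⁻ ω, ENNReal.ofReal (F ω ^ p) ∂μ = ENNReal.ofReal (c ^ p)) {y : ℝ} (hy : 0 ≤ y) :
    ENNReal.ofReal (|y - c| ^ p) ≤ ∫⁻ ω, ENNReal.ofReal (|F ω - y| ^ p) ∂μ := by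
  have hp0 : 0 < p := by linarith
  set q := ENNReal.ofReal p with hq
  have hq1 : 1 ≤ q := by simpa [hq] using ENNReal.ofReal_le_ofReal hp
  have hq0 : q ≠ 0 := (zero_lt_one.trans_le hq1).ne'
  have hnorm : ∀ f : Ω → ℝ, eLpNorm f q μ ^ p = ∫⁻ ω, ENNReal.ofReal (|f ω| ^ p) ∂μ := by
    intro f
    rw [eLpNorm_eq_lintegral_rpow_enorm_toReal hq0 ENNReal.ofReal_ne_top,
      ENNReal.toReal_ofReal hp0.le, ← ENNReal.rpow_mul, one_div_mul_cancel hp0.ne',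
      ENNReal.rpow_one]
    refine lintegral_congr fun ω ↦ ?_
    rw [Real.enorm_eq_ofReal_abs, ENNReal.ofReal_rpow_of_nonneg (abs_nonneg _) hp0.le]
  have hFn : eLpNorm F q μ = ENNReal.ofReal c := by
    have h := hnorm F
    simp only [abs_of_nonneg (hF0 _)] at h
    rw [hFc, ← ENNReal.ofReal_rpow_of_nonneg hc hp0.le] at h
    exact ENNReal.rpow_left_injective hp0.ne' h
  have hyn : eLpNorm (fun _ : Ω ↦ y) q μ = ENNReal.ofReal y := by
    rw [eLpNorm_const _ hq0 (IsProbabilityMeasure.ne_zero μ)]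
    simp [Real.enorm_eq_ofReal hy]
  have hym : AEStronglyMeasurable (fun _ : Ω ↦ y) μ := aestronglyMeasurable_const
  have hsub : AEStronglyMeasurable (F - fun _ ↦ y) μ := hF.aestronglyMeasurable.sub hym
  set e := eLpNorm (F - fun _ ↦ y) q μ with he
  have t1 : ENNReal.ofReal c ≤ e + ENNReal.ofReal y := by
    have := eLpNorm_add_le hsub hym hq1
    rwa [sub_add_cancel, hFn, hyn] at this
  have t2 : ENNReal.ofReal y ≤ ENNReal.ofReal c + e := by
    have := eLpNorm_sub_le hF.aestronglyMeasurable hsub hq1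
    rwa [sub_sub_cancel, hFn, hyn] at this
  have t3 : ENNReal.ofReal |y - c| ≤ e := by
    rcases le_total c y with h | h
    · rw [abs_of_nonneg (sub_nonneg.2 h), ENNReal.ofReal_sub _ hc, tsub_le_iff_right, add_comm]
      exact t2
    · rw [abs_of_nonpos (sub_nonpos.2 h), neg_sub, ENNReal.ofReal_sub _ hy, tsub_le_iff_right]
      exact t1
  rw [← ENNReal.ofReal_rpow_of_nonneg (abs_nonneg _) hp0.le]
  calc _ ≤ e ^ p := ENNReal.rpow_le_rpow t3 hp0.le
    _ = _ := hnorm _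

/-- The probability of a deviation from `c` larger than `ε`. -/
theorem measure_le_abs_sub_const_le {F : Ω → ℝ} (hF : Measurable F) (hF0 : ∀ ω, 0 ≤ F ω)
    {p c : ℝ} (hp : 1 ≤ p) (hc : 0 ≤ c)
    (hFc : ∫⁻ ω, ENNReal.ofReal (F ω ^ p) ∂μ = ENNReal.ofReal (c ^ p)) {s : ℝ} (hs : 0 < s)
    (hexp : ∀ l, 0 ≤ l → ∫⁻ z, ENNReal.ofReal (Real.exp (l * (F z.1 - F z.2))) ∂(μ.prod μ)
      ≤ ENNReal.ofReal (Real.exp (l ^ 2 * s))) {ε : ℝ} (hε : 0 < ε) :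
    μ {ω | ε ≤ |F ω - c|} ≤ ENNReal.ofReal ((p * √s) ^ p * (2 * Real.exp 1) / ε ^ p) := by
  have hp0 : 0 < p := by linarith
  have hεp : 0 < ε ^ p := Real.rpow_pos_of_pos hε p
  have hm := mul_meas_ge_le_lintegral (μ := μ) (f := fun ω ↦ ENNReal.ofReal (|F ω - c| ^ p))
    (by fun_prop) (ENNReal.ofReal (ε ^ p))
  have hsub : {ω | ε ≤ |F ω - c|}
      ⊆ {ω | ENNReal.ofReal (ε ^ p) ≤ ENNReal.ofReal (|F ω - c| ^ p)} := fun ω hω ↦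
    ENNReal.ofReal_le_ofReal (Real.rpow_le_rpow hε.le hω hp0.le)
  -- The constant `c` is the `L^p` norm of `F`, so for each `ω'` the reverse triangle inequality
  -- bounds `|F ω' - c|` by the `L^p` distance from `F` to the constant `F ω'`. Integrating in `ω'`
  -- produces two independent copies.
  have hint : ∫⁻ ω, ENNReal.ofReal (|F ω - c| ^ p) ∂μ
      ≤ ENNReal.ofReal ((p * √s) ^ p * (2 * Real.exp 1)) := by
    calc _ ≤ ∫⁻ ω', ∫⁻ ω, ENNReal.ofReal (|F ω - F ω'| ^ p) ∂μ ∂μ :=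
          lintegral_mono fun ω' ↦ ofReal_abs_sub_rpow_le_lintegral hF hF0 hp hc hFc (hF0 ω')
      _ = ∫⁻ z, ENNReal.ofReal (|F z.1 - F z.2| ^ p) ∂(μ.prod μ) := by
          rw [lintegral_prod_symm' _ (by fun_prop)]
      _ ≤ _ := lintegral_abs_sub_rpow_le hF hs hexp hp0
  rw [ENNReal.ofReal_div_of_pos hεp, ENNReal.le_div_iff_mul_le
    (Or.inl (by simpa using hεp)) (Or.inl ENNReal.ofReal_ne_top), mul_comm]
  exact (mul_le_mul_right (measure_mono hsub) _).trans (hm.trans hint)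

/-- Symmetrization: deviations from `c` are controlled by those of two independent copies. -/
theorem measure_le_two_mul_of_symmetrization {F : Ω → ℝ} (hF : Measurable F) {c ε : ℝ}
    (hhalf : μ {ω | ε ≤ |F ω - c|} ≤ 2⁻¹) :
    μ {ω | 2 * ε ≤ |F ω - c|} ≤ 2 * (μ.prod μ) {z | ε ≤ |F z.1 - F z.2|} := by
  have hset : MeasurableSet {ω | ε ≤ |F ω - c|} := measurableSet_le measurable_const (by fun_prop)
  have hcompl : 2⁻¹ ≤ μ {ω | ε ≤ |F ω - c|}ᶜ := by
    rw [prob_compl_eq_one_sub hset]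
    refine ENNReal.le_sub_of_add_le_left (measure_ne_top _ _) ?_
    calc _ ≤ (2⁻¹ : ENNReal) + 2⁻¹ := by gcongr
      _ = 1 := ENNReal.inv_two_add_inv_two
  have hsub : {ω | 2 * ε ≤ |F ω - c|} ×ˢ {ω | ε ≤ |F ω - c|}ᶜ
      ⊆ {z : Ω × Ω | ε ≤ |F z.1 - F z.2|} := by
    rintro ⟨x, y⟩ ⟨hx, hy⟩
    simp only [Set.mem_ofPred_eq, Set.mem_compl_iff, not_le] at hx hy ⊢
    have : |F x - c| ≤ |F x - F y| + |F y - c| := abs_sub_le _ _ _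
    linarith
  calc μ {ω | 2 * ε ≤ |F ω - c|} = 2 * (μ {ω | 2 * ε ≤ |F ω - c|} * 2⁻¹) := by
        rw [mul_left_comm, ENNReal.mul_inv_cancel (by norm_num) (by norm_num), mul_one]
    _ ≤ 2 * (μ {ω | 2 * ε ≤ |F ω - c|} * μ {ω | ε ≤ |F ω - c|}ᶜ) := by gcongr
    _ = 2 * (μ.prod μ) ({ω | 2 * ε ≤ |F ω - c|} ×ˢ {ω | ε ≤ |F ω - c|}ᶜ) := by
        rw [Measure.prod_prod]
    _ ≤ _ := by gcongr

/-- Almost sure convergence from sub-Gaussian concentration with parameters `s n = o(1 / log n)`. -/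
theorem ae_tendsto_of_subgaussian {F : ℕ → Ω → ℝ} (hF : ∀ n, Measurable (F n))
    (hF0 : ∀ n ω, 0 ≤ F n ω) {p c : ℝ} (hp : 1 ≤ p) (hc : 0 ≤ c) {s : ℕ → ℝ} (hs : ∀ n, 0 < s n)
    (hslim : Tendsto s atTop (𝓝 0)) (hslog : Tendsto (fun n ↦ s n * Real.log n) atTop (𝓝 0))
    (hFc : ∀ᶠ n in atTop, ∫⁻ ω, ENNReal.ofReal (F n ω ^ p) ∂μ = ENNReal.ofReal (c ^ p))
    (hexp : ∀ᶠ n in atTop, ∀ l, 0 ≤ l →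
      ∫⁻ z, ENNReal.ofReal (Real.exp (l * (F n z.1 - F n z.2))) ∂(μ.prod μ)
        ≤ ENNReal.ofReal (Real.exp (l ^ 2 * s n))) :
    ∀ᵐ ω ∂μ, Tendsto (fun n ↦ F n ω) atTop (𝓝 c) := by
  have hp0 : 0 < p := by linarith
  have main : ∀ ε : ℝ, 0 < ε → ∀ᵐ ω ∂μ, ∀ᶠ n in atTop, |F n ω - c| < 2 * ε := by
    intro ε hε
    -- This Markov bound only supplies the probability `1 / 2` required by symmetrization; the
    -- summable tail comes from the exponential estimate.
    have hsmall : ∀ᶠ n in atTop,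
        ENNReal.ofReal ((p * √(s n)) ^ p * (2 * Real.exp 1) / ε ^ p) ≤ 2⁻¹ := by
      have h1 : Tendsto (fun n ↦ p * √(s n)) atTop (𝓝 0) := by
        simpa only [Function.comp_def, Real.sqrt_zero, mul_zero] using
          ((Real.continuous_sqrt.tendsto 0).comp hslim).const_mul p
      have h2 := ((h1.rpow_const (p := p) (Or.inr hp0.le)).mul_const
        (2 * Real.exp 1)).div_const (ε ^ p)
      rw [Real.zero_rpow hp0.ne', zero_mul, zero_div] at h2
      have h3 := ENNReal.tendsto_ofReal h2
      rw [ENNReal.ofReal_zero] at h3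
      exact h3.eventually_le_const (by norm_num)
    have hlog : ∀ᶠ n in atTop, s n * Real.log n ≤ ε ^ 2 / 8 :=
      hslog.eventually_le_const (by positivity)
    have hbound : ∀ᶠ n : ℕ in atTop, μ {ω | 2 * ε ≤ |F n ω - c|}
        ≤ 4 * ENNReal.ofReal (1 / (n : ℝ) ^ 2) := by
      filter_upwards [hsmall, hlog, hFc, hexp, eventually_gt_atTop 0] with n h1 h2 h3 h4 hn
      have hn' : (0 : ℝ) < n := by positivity
      have hhalf := (measure_le_abs_sub_const_le (hF n) (hF0 n) hp hc h3 (hs n) h4 hε).trans h1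
      -- Here `s n * log n ≤ ε² / 8` is exactly what makes the exponent at most `-2 log n`.
      have h5 : Real.exp (-(ε ^ 2 / (4 * s n))) ≤ 1 / (n : ℝ) ^ 2 := by
        have e : 1 / (n : ℝ) ^ 2 = Real.exp (-(2 * Real.log n)) := by
          rw [Real.exp_neg, two_mul, Real.exp_add, Real.exp_log hn', one_div, sq]
        rw [e, Real.exp_le_exp, neg_le_neg_iff, le_div_iff₀ (by have := hs n; positivity)]
        linarith
      calc _ ≤ 2 * (2 * ENNReal.ofReal (Real.exp (-(ε ^ 2 / (4 * s n))))) :=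
            (measure_le_two_mul_of_symmetrization (hF n) hhalf).trans
              (mul_le_mul_right (measure_le_abs_sub_le (hF n) (hs n) h4 hε.le) _)
        _ = 4 * ENNReal.ofReal (Real.exp (-(ε ^ 2 / (4 * s n)))) := by
            rw [← mul_assoc]; norm_num
        _ ≤ _ := by gcongr
    obtain ⟨N, hN⟩ := eventually_atTop.1 hbound
    have hsum : ∑' n, μ {ω | 2 * ε ≤ |F (n + N) ω - c|} ≠ ⊤ := by
      have h1 : Summable fun n : ℕ ↦ 1 / ((n + N : ℕ) : ℝ) ^ 2 :=
        (summable_nat_add_iff N).2 (Real.summable_one_div_nat_pow.2 one_lt_two)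
      refine ne_top_of_le_ne_top ?_ (ENNReal.tsum_le_tsum fun n ↦ hN (n + N) (Nat.le_add_left _ _))
      rw [ENNReal.tsum_mul_left]
      exact ENNReal.mul_ne_top (by norm_num) h1.tsum_ofReal_ne_top
    filter_upwards [ae_eventually_notMem hsum] with ω hω
    filter_upwards [(tendsto_sub_atTop_nat N).eventually hω, eventually_ge_atTop N] with n h1 h2
    simp only [Nat.sub_add_cancel h2, not_le] at h1
    exact h1
  have hall : ∀ᵐ ω ∂μ, ∀ k : ℕ, ∀ᶠ n in atTop, |F n ω - c| < 2 * (1 / ((k : ℝ) + 1)) :=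
    ae_all_iff.2 fun k ↦ main _ Nat.one_div_pos_of_nat
  filter_upwards [hall] with ω hω
  rw [Metric.tendsto_nhds]
  intro ε hε
  obtain ⟨k, hk⟩ := exists_nat_one_div_lt (half_pos hε)
  filter_upwards [hω k] with n hn
  rw [Real.dist_eq]
  linarith

end Concentration

/-! ### Extension from short rational intervals to all intervals -/

section Intervals

/-- Convergence of interval integrals of nonnegative functions on short rational intervals
extends to all short intervals. -/
theorem tendsto_intervalIntegral_of_rat {f : ℕ → ℝ → ℝ} (hf0 : ∀ n x, 0 ≤ f n x)
    (hfi : ∀ n a b, IntervalIntegrable (f n) volume a b) {K d : ℝ} (hK : 0 ≤ K)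
    (hrat : ∀ q r : ℚ, (q : ℝ) < r → (r : ℝ) - q < d →
      Tendsto (fun n ↦ ∫ x in (q : ℝ)..r, f n x) atTop (𝓝 (K * (r - q))))
    {a b : ℝ} (hab : a < b) (hd : b - a < d) :
    Tendsto (fun n ↦ ∫ x in a..b, f n x) atTop (𝓝 (K * (b - a))) := by
  have hmono : ∀ n {s t u v : ℝ}, s ≤ t → t ≤ u → u ≤ v →
      ∫ x in t..u, f n x ≤ ∫ x in s..v, f n x := fun n s t u v h1 h2 h3 ↦
    intervalIntegral.integral_mono_interval h1 h2 h3 (ae_of_all _ fun x ↦ hf0 n x) (hfi _ _ _)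
  rw [Metric.tendsto_nhds]
  intro ε hε
  obtain ⟨η, hη0, hη⟩ : ∃ η : ℝ, 0 < η ∧ K * (2 * η) < ε / 2 ∧ 2 * η < b - a
      ∧ 2 * η < d - (b - a) := by
    have hcont : Tendsto (fun η : ℝ ↦ K * (2 * η)) (𝓝[>] 0) (𝓝 0) := by
      have : Continuous fun η : ℝ ↦ K * (2 * η) := by fun_prop
      simpa using (this.tendsto 0).mono_left nhdsWithin_le_nhds
    have hcont2 : Tendsto (fun η : ℝ ↦ 2 * η) (𝓝[>] 0) (𝓝 0) := by
      have : Continuous fun η : ℝ ↦ 2 * η := by fun_prop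
      simpa using (this.tendsto 0).mono_left nhdsWithin_le_nhds
    have h1 := hcont.eventually_lt_const (half_pos hε)
    have h2 := hcont2.eventually_lt_const (sub_pos.2 hab)
    have h3 := hcont2.eventually_lt_const (sub_pos.2 hd)
    obtain ⟨η, h⟩ := (((h1.and h2).and h3).and self_mem_nhdsWithin).exists
    exact ⟨η, h.2, h.1.1.1, h.1.1.2, h.1.2⟩
  obtain ⟨hη1, hη2, hη3⟩ := hη
  -- Nonnegativity squeezes the integral over `[a, b]` between those over rational intervals inside
  -- and around it, whose lengths differ from `b - a` by at most `2 η`.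
  obtain ⟨q1, hq1, hq1'⟩ := exists_rat_btwn (show a - η < a by linarith)
  obtain ⟨q2, hq2, hq2'⟩ := exists_rat_btwn (show a < a + η by linarith)
  obtain ⟨r1, hr1, hr1'⟩ := exists_rat_btwn (show b < b + η by linarith)
  obtain ⟨r2, hr2, hr2'⟩ := exists_rat_btwn (show b - η < b by linarith)
  have t1 := hrat q1 r1 (by linarith) (by linarith)
  have t2 := hrat q2 r2 (by linarith) (by linarith)
  filter_upwards [t1.eventually_lt_const (show K * (r1 - q1) < K * (r1 - q1) + ε / 2 by linarith),
    t2.eventually_const_lt (show K * (r2 - q2) - ε / 2 < K * (r2 - q2) by linarith)] with n h1 h2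
  have m1 := hmono n hq1'.le hab.le hr1.le
  have m2 := hmono n hq2.le (show (q2 : ℝ) ≤ r2 by linarith) hr2'.le
  have k1 : K * (r1 - q1) ≤ K * (b - a) + K * (2 * η) := by
    rw [← mul_add]; exact mul_le_mul_of_nonneg_left (by linarith) hK
  have k2 : K * (b - a) ≤ K * (r2 - q2) + K * (2 * η) := by
    rw [← mul_add]; exact mul_le_mul_of_nonneg_left (by linarith) hK
  rw [Real.dist_eq, abs_lt]
  constructor <;> linarith

/-- Convergence of interval integrals on short intervals extends to all intervals. -/
theorem tendsto_intervalIntegral_of_short {f : ℕ → ℝ → ℝ}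
    (hfi : ∀ n a b, IntervalIntegrable (f n) volume a b) {K d : ℝ} (hd0 : 0 < d)
    (hshort : ∀ a b : ℝ, a < b → b - a < d →
      Tendsto (fun n ↦ ∫ x in a..b, f n x) atTop (𝓝 (K * (b - a)))) (a b : ℝ) :
    Tendsto (fun n ↦ ∫ x in a..b, f n x) atTop (𝓝 (K * (b - a))) := by
  -- Bisection doubles the admissible length at each step.
  have hpow : ∀ k : ℕ, ∀ a b : ℝ, a < b → b - a < 2 ^ k * d →
      Tendsto (fun n ↦ ∫ x in a..b, f n x) atTop (𝓝 (K * (b - a))) := by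
    intro k
    induction k with
    | zero => intro a b hab h; exact hshort a b hab (by simpa using h)
    | succ k ih =>
      intro a b hab h
      rw [pow_succ] at h
      have h1 := ih a ((a + b) / 2) (by linarith) (by linarith)
      have h2 := ih ((a + b) / 2) b (by linarith) (by linarith)
      have h3 := h1.add h2
      simp only [intervalIntegral.integral_add_adjacent_intervals (hfi _ _ _) (hfi _ _ _)] at h3
      convert h3 using 2
      ring
  have hlt : ∀ a b : ℝ, a < b →
      Tendsto (fun n ↦ ∫ x in a..b, f n x) atTop (𝓝 (K * (b - a))) := by
    intro a b hab
    obtain ⟨k, hk⟩ := pow_unbounded_of_one_lt ((b - a) / d) one_lt_two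
    exact hpow k a b hab ((div_lt_iff₀ hd0).1 hk)
  rcases lt_trichotomy a b with h | h | h
  · exact hlt a b h
  · subst h; simp
  · have := (hlt b a h).neg
    simp only [← intervalIntegral.integral_symm] at this
    convert this using 2
    ring

end Intervals

/-! ### Consequences of the rate of `h` -/

section Rates

/-- The hypothesis says `h n * (log n) ^ p → 0`; this is its root of order `p`. -/
theorem tendsto_rpow_mul_log_of_isLittleO {p : ℝ} (hp : 0 < p) {h : ℕ → ℝ} (hpos : ∀ n, 0 < h n)
    (hlim : h =o[atTop] fun n : ℕ ↦ 1 / Real.log n ^ p) :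
    Tendsto (fun n ↦ h n ^ (1 / p) * Real.log n) atTop (𝓝 0) := by
  have h1 := (hlim.tendsto_div_nhds_zero).rpow_const (p := 1 / p) (Or.inr (by positivity))
  rw [Real.zero_rpow (by positivity)] at h1
  refine h1.congr fun n ↦ ?_
  have hl : 0 ≤ Real.log n := Real.log_natCast_nonneg n
  rw [one_div (Real.log n ^ p), div_inv_eq_mul, Real.mul_rpow (hpos n).le (by positivity),
    ← Real.rpow_mul hl, mul_one_div_cancel hp.ne', Real.rpow_one]

theorem tendsto_zero_of_isLittleO_log {p : ℝ} (hp : 0 < p) {h : ℕ → ℝ}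
    (hlim : h =o[atTop] fun n : ℕ ↦ 1 / Real.log n ^ p) : Tendsto h atTop (𝓝 0) := by
  refine hlim.trans_tendsto ?_
  simp only [one_div]
  exact ((tendsto_rpow_atTop hp).comp
    (Real.tendsto_log_atTop.comp tendsto_natCast_atTop_atTop)).inv_tendsto_atTop

end Rates

/-! ### Passing to a jointly measurable version -/

section MeasurableVersion

variable {Ω : Type*} [MeasurableSpace Ω] {μ : Measure Ω} [IsProbabilityMeasure μ]
  {G : ℝ → Ω → ℝ} {H : ℝ × Ω → ℝ}

/-- The standardized increments of a jointly measurable version `H` of `G`. -/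
noncomputable def versionIncrement (G : ℝ → Ω → ℝ) (μ : Measure Ω) (H : ℝ × Ω → ℝ) (h x : ℝ)
    (ω : Ω) : ℝ :=
  (H (x + h, ω) - H (x, ω)) / incrementStd G μ h

omit [IsProbabilityMeasure μ] in
theorem measurable_versionIncrement (hH : Measurable H) (h : ℝ) :
    Measurable fun z : ℝ × Ω ↦ versionIncrement G μ H h z.1 z.2 := by
  unfold versionIncrement
  fun_prop

omit [IsProbabilityMeasure μ] in
theorem ae_add_right_of_ae {P : ℝ → Prop} (hP : ∀ᵐ x, P x) (h : ℝ) : ∀ᵐ x, P (x + h) :=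
  (measurePreserving_add_right volume h).quasiMeasurePreserving.ae hP

theorem ae_stdIncrement_eq_version
    (hGH : (fun z : ℝ × Ω ↦ G z.1 z.2) =ᵐ[(volume : Measure ℝ).prod μ] H) (h : ℝ) :
    ∀ᵐ x, stdIncrement G μ h x =ᵐ[μ] versionIncrement G μ H h x := by
  have h1 : ∀ᵐ x, ∀ᵐ ω ∂μ, G x ω = H (x, ω) := Measure.ae_ae_of_ae_prod hGH
  filter_upwards [h1, ae_add_right_of_ae h1 h] with x hx1 hx2
  filter_upwards [hx1, hx2] with ω e1 e2
  simp only [stdIncrement, versionIncrement, e1, e2]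

/-- Fubini in the other order. Translation invariance of Lebesgue measure makes the exceptional set
of `ω` independent of `h`. -/
theorem ae_forall_stdIncrement_eq_version
    (hGH : (fun z : ℝ × Ω ↦ G z.1 z.2) =ᵐ[(volume : Measure ℝ).prod μ] H) :
    ∀ᵐ ω ∂μ, ∀ h, ∀ᵐ x, stdIncrement G μ h x ω = versionIncrement G μ H h x ω := by
  have h1 : ∀ᵐ ω ∂μ, ∀ᵐ x, G x ω = H (x, ω) :=
    Measure.ae_ae_of_ae_prod (Measure.measurePreserving_swap.quasiMeasurePreserving.ae hGH)
  filter_upwards [h1] with ω hω h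
  filter_upwards [hω, ae_add_right_of_ae hω h] with x e1 e2
  simp only [stdIncrement, versionIncrement, e1, e2]

variable (hG : IsGaussianProcess G μ) (hmean : ∀ x, ∫ ω, G x ω ∂μ = 0)
  (hstat : HasStationaryIncrements G μ) (hH : Measurable H)
  (hGH : (fun z : ℝ × Ω ↦ G z.1 z.2) =ᵐ[(volume : Measure ℝ).prod μ] H)

include hG hmean hstat hH hGH

/-- For almost every `x` the increment is standard normal, so the mean does not depend on `h`. This
fixes the centre of concentration exactly. -/
theorem lintegral_versionIncrement_rpow {p : ℝ} (hp : 0 < p) {a b : ℝ} (hab : a < b) {h : ℝ}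
    (hh : 0 < incrementVariance G μ h) :
    ∫⁻ z, ENNReal.ofReal (|versionIncrement G μ H h z.1 z.2| ^ p) ∂((uniformIoc a b).prod μ)
      = ENNReal.ofReal (∫ y, |y| ^ p ∂(gaussianReal 0 1)) := by
  have := isProbabilityMeasure_uniformIoc hab
  have hXm := measurable_versionIncrement (μ := μ) (G := G) hH h
  rw [lintegral_prod _ (by fun_prop)]
  calc _ = ∫⁻ _x, ENNReal.ofReal (∫ y, |y| ^ p ∂(gaussianReal 0 1)) ∂(uniformIoc a b) := by
        refine lintegral_congr_ae ?_
        filter_upwards [ae_uniformIoc (ae_stdIncrement_eq_version hGH h)] with x hx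
        have hXx : Measurable (versionIncrement G μ H h x) := hXm.comp measurable_prodMk_left
        rw [ofReal_integral_eq_lintegral_ofReal (integrable_abs_rpow_gaussianReal hp)
          (ae_of_all _ fun _ ↦ by positivity), ← map_stdIncrement hG hmean hstat hh x,
          Measure.map_congr hx.2, lintegral_map (by fun_prop) hXx]
    _ = _ := by simp

theorem ae_integrable_versionIncrement_rpow {p : ℝ} (hp : 0 < p) {a b : ℝ} (hab : a < b) {h : ℝ}
    (hh : 0 < incrementVariance G μ h) :
    ∀ᵐ ω ∂μ, Integrable (fun x ↦ |versionIncrement G μ H h x ω| ^ p) (uniformIoc a b) := by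
  have := isProbabilityMeasure_uniformIoc hab
  have hXm := measurable_versionIncrement (μ := μ) (G := G) hH h
  have hint : Integrable (fun z : ℝ × Ω ↦ |versionIncrement G μ H h z.1 z.2| ^ p)
      ((uniformIoc a b).prod μ) := by
    have hp' := hp.le
    refine ⟨by fun_prop, ?_⟩
    rw [hasFiniteIntegral_iff_ofReal (ae_of_all _ fun _ ↦ by positivity),
      lintegral_versionIncrement_rpow hG hmean hstat hH hGH hp hab hh]
    exact ENNReal.ofReal_lt_top
  exact hint.prod_left_ae

theorem ae_forall_intervalIntegrable_versionIncrement {p : ℝ} (hp : 0 < p) (h : ℝ) :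
    ∀ᵐ ω ∂μ, ∀ a b,
      IntervalIntegrable (fun x ↦ |versionIncrement G μ H h x ω| ^ p) volume a b := by
  rcases (incrementVariance_nonneg (G := G) (μ := μ) h).eq_or_lt with h0 | h0
  · refine ae_of_all _ fun ω a b ↦ ?_
    -- When `σ(h) = 0`, division by zero makes the integrand constant.
    simp [versionIncrement, incrementStd, ← h0]
  · have : ∀ᵐ ω ∂μ, ∀ k : ℕ, Integrable (fun x ↦ |versionIncrement G μ H h x ω| ^ p)
        (uniformIoc (-((k : ℝ) + 1)) (k + 1)) :=
      ae_all_iff.2 fun k ↦ ae_integrable_versionIncrement_rpow hG hmean hstat hH hGH hp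
        (by have : (0 : ℝ) ≤ k := k.cast_nonneg
            linarith) h0
    filter_upwards [this] with ω hω a b
    obtain ⟨k, hk⟩ := exists_nat_ge (max |a| |b|)
    have ha := abs_le.1 ((le_max_left _ _).trans hk)
    have hb := abs_le.1 ((le_max_right _ _).trans hk)
    have hk0 : (0 : ℝ) ≤ k := k.cast_nonneg
    have h1 := hω k
    rw [uniformIoc, integrable_smul_measure (by simp; linarith) ENNReal.ofReal_ne_top] at h1
    rw [intervalIntegrable_iff]
    refine h1.mono_measure (Measure.restrict_mono (fun x hx ↦ ?_) le_rfl)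
    rw [Set.uIoc, Set.mem_Ioc] at hx
    refine ⟨lt_of_le_of_lt ?_ hx.1, hx.2.trans ?_⟩
    · exact le_min (by linarith [ha.1]) (by linarith [hb.1])
    · exact max_le (by linarith [ha.2]) (by linarith [hb.2])

theorem ae_tendsto_versionIncrement {δ : ℝ} (hδ : 0 < δ)
    (hconc : ConcaveOn ℝ (Set.Icc 0 δ) (incrementVariance G μ))
    (hmono : MonotoneOn (incrementVariance G μ) (Set.Icc 0 δ))
    (hnondeg : 0 < incrementVariance G μ δ) {p : ℝ} (hp : 1 ≤ p) {h : ℕ → ℝ}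
    (hpos : ∀ n, 0 < h n) (hlim : h =o[atTop] fun n : ℕ ↦ 1 / Real.log n ^ p) {a b : ℝ}
    (hab : a < b) (hd : b - a < δ) :
    ∀ᵐ ω ∂μ, Tendsto (fun n ↦ ∫ x in a..b, |versionIncrement G μ H (h n) x ω| ^ p) atTop
      (𝓝 ((∫ y, |y| ^ p ∂(gaussianReal 0 1)) * (b - a))) := by
  have hp0 : 0 < p := by linarith
  have hL : 0 < b - a := sub_pos.2 hab
  have := isProbabilityMeasure_uniformIoc hab
  have hh0 := tendsto_zero_of_isLittleO_log hp0 hlim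
  have hXm := fun n ↦ measurable_versionIncrement (μ := μ) (G := G) hH (h n)
  set m : ℝ := ∫ y, |y| ^ p ∂(gaussianReal 0 1) with hm
  have hm0 : 0 ≤ m := integral_nonneg fun y ↦ by positivity
  set π := uniformIoc a b with hπ
  set F : ℕ → Ω → ℝ := fun n ω ↦ (∫ x, |versionIncrement G μ H (h n) x ω| ^ p ∂π) ^ (1 / p) with hF
  set s : ℕ → ℝ := fun n ↦ Real.pi ^ 2 * (2 * (3 * h n / (b - a))) ^ (1 / p) / 8 with hs
  have hint0 : ∀ n ω, 0 ≤ ∫ x, |versionIncrement G μ H (h n) x ω| ^ p ∂π := fun n ω ↦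
    integral_nonneg fun x ↦ by positivity
  have hFm : ∀ n, Measurable (F n) := fun n ↦ by
    have hg : Measurable fun z : ℝ × Ω ↦ |versionIncrement G μ H (h n) z.1 z.2| ^ p := by
      have := hXm n
      fun_prop
    exact ((hg.stronglyMeasurable.integral_prod_left' (μ := π)).measurable).pow_const _
  have hFp : ∀ n ω, F n ω ^ p = ∫ x, |versionIncrement G μ H (h n) x ω| ^ p ∂π := fun n ω ↦ by
    rw [hF, ← Real.rpow_mul (hint0 n ω), one_div_mul_cancel hp0.ne', Real.rpow_one]
  have hcp : (m ^ (1 / p)) ^ p = m := by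
    rw [← Real.rpow_mul hm0, one_div_mul_cancel hp0.ne', Real.rpow_one]
  have hs0 : ∀ n, 0 < s n := fun n ↦ by
    have := hpos n
    positivity
  have hslim : Tendsto s atTop (𝓝 0) := by
    have h1 := ((((hh0.const_mul 3).div_const (b - a)).const_mul 2).rpow_const (p := 1 / p)
      (Or.inr (by positivity))).const_mul (Real.pi ^ 2) |>.div_const 8
    simpa only [mul_zero, zero_div, Real.zero_rpow (one_div_pos.2 hp0).ne'] using h1
  have hslog : Tendsto (fun n ↦ s n * Real.log n) atTop (𝓝 0) := by
    have h1 := (tendsto_rpow_mul_log_of_isLittleO hp0 hpos hlim).const_mul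
      (Real.pi ^ 2 * (6 / (b - a)) ^ (1 / p) / 8)
    rw [mul_zero] at h1
    refine h1.congr fun n ↦ ?_
    rw [hs]
    simp only
    rw [show 2 * (3 * h n / (b - a)) = 6 / (b - a) * h n by ring,
      Real.mul_rpow (by positivity) (hpos n).le]
    ring
  have hsmall : ∀ᶠ n in atTop, h n ≤ b - a ∧ b - a + h n ≤ δ ∧ 0 < incrementVariance G μ (h n) := by
    filter_upwards [hh0.eventually_lt_const hL, hh0.eventually_lt_const (sub_pos.2 hd)] with n h1 h2
    refine ⟨h1.le, by linarith, ?_⟩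
    -- Concavity and `σ²(0) = 0` give `σ²(h n) ≥ (h n / δ) σ²(δ) > 0`.
    have h3 := hconc.div_mul_le_of_zero incrementVariance_zero (hpos n).le
      (by linarith : h n ≤ δ) hδ le_rfl
    have := hpos n
    exact lt_of_lt_of_le (by positivity) h3
  have hFc : ∀ᶠ n in atTop,
      ∫⁻ ω, ENNReal.ofReal (F n ω ^ p) ∂μ = ENNReal.ofReal ((m ^ (1 / p)) ^ p) := by
    filter_upwards [hsmall] with n hn
    have hXn := hXm n
    rw [hcp, ← lintegral_versionIncrement_rpow hG hmean hstat hH hGH hp0 hab hn.2.2,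
      lintegral_prod_symm' _ (by fun_prop)]
    refine lintegral_congr_ae ?_
    filter_upwards [ae_integrable_versionIncrement_rpow hG hmean hstat hH hGH hp0 hab hn.2.2]
      with ω hω
    rw [hFp, ofReal_integral_eq_lintegral_ofReal hω (ae_of_all _ fun _ ↦ by positivity)]
  have hexp : ∀ᶠ n in atTop, ∀ l, 0 ≤ l →
      ∫⁻ z, ENNReal.ofReal (Real.exp (l * (F n z.1 - F n z.2))) ∂(μ.prod μ)
        ≤ ENNReal.ofReal (Real.exp (l ^ 2 * s n)) := by
    filter_upwards [hsmall] with n hn l hl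
    have hcm := measurable_incrementCorr hmono hδ.le (h n)
    -- Sample points are restricted to those in `(a, b]` where `H` reproduces the increment almost
    -- surely. The pair bound is `V = 3 h n / (b - a)`, and sampling doubles it, whence the form of
    -- `s n`.
    exact lintegral_exp_lpMean_sub_le (isGaussianProcess_stdIncrement hG (h n)) (hXm n)
      (integral_stdIncrement hG hmean (h n)) (map_stdIncrement hG hmean hstat hn.2.2)
      (P := fun x ↦ x ∈ Set.Ioc a b ∧ stdIncrement G μ (h n) x =ᵐ[μ] versionIncrement G μ H (h n) x)
      (ae_uniformIoc (ae_stdIncrement_eq_version hGH (h n))) (fun x hx ↦ hx.2) hp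
      (r := fun z ↦ min 1 |incrementCorr (incrementVariance G μ) δ (h n) (z.1 - z.2)|)
      (by fun_prop) (fun z ↦ min_le_left _ _) (fun z ↦ le_min zero_le_one (abs_nonneg _))
      (fun x y hx hy ↦ abs_integral_stdIncrement_mul_le_corr hG hstat (hpos n).le hn.2.2 hn.2.1
        hx.1 hy.1)
      (by have := hpos n
          positivity)
      (lintegral_pair_incrementCorr_le hconc hmono incrementVariance_zero hab (hpos n) hn.1 hn.2.1
        hn.2.2) hl
  filter_upwards [ae_tendsto_of_subgaussian hFm (fun n ω ↦ by
    have := hint0 n ω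
    positivity) hp (by positivity) hs0 hslim hslog hFc hexp] with ω hω
  have h1 := (hω.rpow_const (p := p) (Or.inr hp0.le)).mul_const (b - a)
  rw [hcp] at h1
  refine h1.congr fun n ↦ ?_
  rw [hFp, integral_uniformIoc hab]
  field_simp

end MeasurableVersion

/-! ### Conclusion of the proof -/

theorem theorem2p1 {Ω : Type*} [MeasurableSpace Ω] (μ : Measure Ω) [IsProbabilityMeasure μ]
    (G : ℝ → Ω → ℝ)
    (hGauss : IsGaussianProcess G μ)
    (hmeas : AEMeasurable (fun z : ℝ × Ω ↦ G z.1 z.2) ((volume : Measure ℝ).prod μ))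
    (hmean : ∀ x, ∫ ω, G x ω ∂μ = 0)
    (hstat : HasStationaryIncrements G μ)
    (δ : ℝ) (hδ : 0 < δ)
    (hconc : ConcaveOn ℝ (Set.Icc 0 δ) (incrementVariance G μ))
    (hmono : MonotoneOn (incrementVariance G μ) (Set.Icc 0 δ))
    (hnondeg : 0 < incrementVariance G μ δ)
    (p : ℝ) (hp : 1 ≤ p)
    (h : ℕ → ℝ) (hpos : ∀ n, 0 < h n)
    (hlim : h =o[atTop] fun n : ℕ ↦ 1 / Real.log n ^ p) :
    ∀ᵐ ω ∂μ, ∀ a b : ℝ,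
      (∀ n, IntervalIntegrable
        (fun x ↦ |(G (x + h n) ω - G x ω) / incrementStd G μ (h n)| ^ p) volume a b) ∧
      Tendsto
        (fun n ↦ ∫ x in a..b, |(G (x + h n) ω - G x ω) / incrementStd G μ (h n)| ^ p)
        atTop (𝓝 ((∫ y, |y| ^ p ∂(gaussianReal 0 1)) * (b - a))) := by
  have hp0 : 0 < p := by linarith
  set H : ℝ × Ω → ℝ := hmeas.mk _ with hH_def
  have hH : Measurable H := hmeas.measurable_mk
  have hGH : (fun z : ℝ × Ω ↦ G z.1 z.2) =ᵐ[(volume : Measure ℝ).prod μ] H := hmeas.ae_eq_mk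
  have hint : ∀ᵐ ω ∂μ, ∀ n a b,
      IntervalIntegrable (fun x ↦ |versionIncrement G μ H (h n) x ω| ^ p) volume a b :=
    ae_all_iff.2 fun n ↦
      ae_forall_intervalIntegrable_versionIncrement hGauss hmean hstat hH hGH hp0 (h n)
  -- Countably many rational pairs give a single null set, outside which the extension to real
  -- endpoints is deterministic.
  have hrat : ∀ᵐ ω ∂μ, ∀ q r : ℚ, (q : ℝ) < r → (r : ℝ) - q < δ →
      Tendsto (fun n ↦ ∫ x in (q : ℝ)..r, |versionIncrement G μ H (h n) x ω| ^ p) atTop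
        (𝓝 ((∫ y, |y| ^ p ∂(gaussianReal 0 1)) * (r - q))) := by
    simp only [ae_all_iff]
    intro q r hqr hd
    exact ae_tendsto_versionIncrement hGauss hmean hstat hH hGH hδ hconc hmono hnondeg hp hpos hlim
      hqr hd
  filter_upwards [hint, hrat, ae_forall_stdIncrement_eq_version hGH] with ω h1 h2 h3 a b
  have heq : ∀ n, (fun x ↦ |versionIncrement G μ H (h n) x ω| ^ p) =ᵐ[volume]
      fun x ↦ |(G (x + h n) ω - G x ω) / incrementStd G μ (h n)| ^ p := fun n ↦ by
    filter_upwards [h3 (h n)] with x hx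
    rw [← hx, stdIncrement]
  refine ⟨fun n ↦ (h1 n a b).congr_ae (ae_restrict_of_ae (heq n)), ?_⟩
  have hlimit := tendsto_intervalIntegral_of_short (f := fun n x ↦ |versionIncrement G μ H (h n) x ω| ^ p)
    h1 hδ (fun a b hab hd ↦ tendsto_intervalIntegral_of_rat (fun n x ↦ by positivity) h1
      (integral_nonneg fun y ↦ by positivity) h2 hab hd) a b
  refine hlimit.congr fun n ↦ ?_
  exact intervalIntegral.integral_congr_ae ((heq n).mono fun x hx _ ↦ hx)
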